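/- Let $(\Omega,\mathcal F,\mu)$ be a $\sigma$-finite measure space. Measurable sets and functions are identified when they agree up to null sets; $L^0(E)$ is the space of (classes of) measurable functions $\Omega\to E$, and $L^0_{++}(\mathbb Q)=\{r\in L^0(\mathbb Q): r>0\}$. A partition is a countable measurable partition of $\Omega$ (up to null sets). For a partition $(A_k)$, $\sum_k x_k|A_k$ denotes the function that equals $x_k$ on $A_k$, and $\sum_k W_k|A_k=\{\sum_k x_k|A_k : x_k\in W_k\}$. A set of such functions is stable if it is nonempty and closed under all countable concatenations $\sum_k x_k|A_k$ of its elements. A function on a set of such functions is called stable if it commutes with concatenations. A conditional sequence in (or of subsets of) a space is a stable function on $L^0(\mathbb N)$, where for set values $O_{\sum_k i_k|A_k}=\sum_k O_{i_k}|A_k$ is required. Let $n=\sum_k n_k|A_k\in L^0(\mathbb N)$ with $n_k\in\mathbb N$ and $(A_k)$ a partition, and let $L^0(\mathbb R)^n=\sum_k L^0(\mathbb R)^{n_k}|A_k$, i.e. the set of measurable $x$ with $x(\omega)\in\mathbb R^{n(\omega)}$ for a.e. $\omega$, with the $L^0$-valued Euclidean norm $\|x\|(\omega)=\|x(\omega)\|$.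 A conditional sequence $(x_k)_{k\in L^0(\mathbb N)}$ converges conditionally to $y$ if for every $r\in L^0_{++}(\mathbb Q)$ there is $m\in L^0(\mathbb N)$ with $\|x_k-y\|<r$ a.e. for all $k\ge m$ in $L^0(\mathbb N)$. A conditional subsequence is obtained by composing with a stable $\kappa\colon L^0(\mathbb N)\to L^0(\mathbb N)$ that is strictly increasing, i.e. $\kappa(i)<\kappa(j)$ a.e. on $\{i<j\}$. The conditional union $\sqcup_i O_i$ of a family of sets is the set of all $x$ such that the measurable sets $B$ for which $x|_B=y|_B$ for some $i$ and some $y\in O_i$ have union (supremum in the measure algebra) $\Omega$. An open set in $L^0(\mathbb R)^n$ is a conditional union $\sqcup_k B(q_k,r_k)$ where $(q_k)$ and $(r_k)$ are conditional sequences in $L^0(\mathbb Q)^n$ and $L^0_{++}(\mathbb Q)$ and $B(q,r)=\{x\in L^0(\mathbb R)^n:\|x-q\|<r\text{ a.e.}\}$. Let $W\subseteq L^0(\mathbb R)^n$ be stable. Then the following are equivalent. (i) $W$ is conditionally (sequentially) compact: every conditional sequence in $W$ has a conditional subsequence converging conditionally to an element of $W$. (ii) (Heine–Borel property) For every conditional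 sequence $(O_i)$ of open sets with $W\subseteq\sqcup_i O_i$ there is a conditionally finite subsequence $(O_{i_j})_{1\le j\le m}$, i.e. some $m\in L^0(\mathbb N)$, $m\ge1$, and a stable function $j\mapsto i_j$ from $\{j\in L^0(\mathbb N):1\le j\le m\}$ to $L^0(\mathbb N)$ with $i_j<i_{j'}$ a.e. on $\{j<j'\}$, such that $W\subseteq\sqcup_{1\le j\le m}O_{i_j}$. (iii) $W=\sum_k W_k|A_k$ where, for each $k$, $W_k\subseteq L^0(\mathbb R)^{n_k}$ is the set of almost everywhere selections of a compact-valued map $X_k\colon\Omega\to 2^{\mathbb R^{n_k}}$ that is Effros measurable, i.e. $\{\omega: X_k(\omega)\cap U\ne\emptyset\}\in\mathcal F$ for every open $U\subseteq\mathbb R^{n_k}$. -/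

import Mathlib

open MeasureTheory

namespace CondAnalysis

/-- The disjoint union of all Euclidean spaces `ℝ^k`, `k ∈ ℕ`, with its disjoint-union topology.
A point is a pair consisting of a dimension and a vector of that dimension. -/
abbrev EucVec : Type := Σ k : ℕ, EuclideanSpace ℝ (Fin k)

/-- The Euclidean distance of two vectors of equal dimension (the value `1` for vectors of
different dimensions is never used). -/
noncomputable def eucDist (u v : EucVec) : ℝ :=
  if h : u.1 = v.1 then ‖h ▸ u.2 - v.2‖ else 1

theorem eucDist_mk (k : ℕ) (u v : EuclideanSpace ℝ (Fin k)) :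
    eucDist ⟨k, u⟩ ⟨k, v⟩ = ‖u - v‖ := by
  simp [eucDist]

section General

variable {Ω : Type*} [MeasurableSpace Ω] {μ : Measure Ω}
variable {E F : Type*} [TopologicalSpace E] [TopologicalSpace F]

/-- A countable measurable partition of `Ω`, up to null sets (members may be null). -/
def IsPartition (μ : Measure Ω) (A : ℕ → Set Ω) : Prop :=
  (∀ k, MeasurableSet (A k)) ∧ (∀ k l, k ≠ l → μ (A k ∩ A l) = 0) ∧
    ∀ᵐ ω ∂μ, ω ∈ ⋃ k, A k

/-- `x|B = y|B`. -/
def EqOnSet (B : Set Ω) (x y : Ω →ₘ[μ] E) : Prop :=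
  ∀ᵐ ω ∂μ, ω ∈ B → x ω = y ω

/-- `y = ∑ₖ xₖ|Aₖ`. -/
def IsConcat (A : ℕ → Set Ω) (x : ℕ → (Ω →ₘ[μ] E)) (y : Ω →ₘ[μ] E) : Prop :=
  ∀ k, EqOnSet (A k) y (x k)

/-- The set `∑ₖ Wₖ|Aₖ` of all concatenations `∑ₖ xₖ|Aₖ` with `xₖ ∈ Wₖ`. -/
def setConcat (A : ℕ → Set Ω) (W : ℕ → Set (Ω →ₘ[μ] E)) : Set (Ω →ₘ[μ] E) :=
  {y | ∃ x : ℕ → (Ω →ₘ[μ] E), (∀ k, x k ∈ W k) ∧ IsConcat A x y}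

/-- Nonempty and closed under countable concatenations. -/
def IsStable (W : Set (Ω →ₘ[μ] E)) : Prop :=
  W.Nonempty ∧ ∀ A : ℕ → Set Ω, IsPartition μ A →
    ∀ x : ℕ → (Ω →ₘ[μ] E), (∀ k, x k ∈ W) → ∀ y, IsConcat A x y → y ∈ W

/-- `f` is a conditional (stable) function on `D`: it commutes with countable concatenations
of elements of `D`. -/
def IsCondFunOn (D : Set (Ω →ₘ[μ] E)) (f : (Ω →ₘ[μ] E) → (Ω →ₘ[μ] F)) : Prop :=
  ∀ A : ℕ → Set Ω, IsPartition μ A →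
    ∀ x : ℕ → (Ω →ₘ[μ] E), (∀ k, x k ∈ D) → ∀ y ∈ D,
      IsConcat A x y → IsConcat A (fun k => f (x k)) (f y)

/-- A conditional sequence in `L⁰(E)`: a stable function on `L⁰(ℕ)`. -/
def IsCondSeq (x : (Ω →ₘ[μ] ℕ) → (Ω →ₘ[μ] E)) : Prop :=
  IsCondFunOn Set.univ x

/-- A conditional sequence of subsets of `L⁰(E)`: `O_{∑ iₖ|Aₖ} = ∑ O_{iₖ}|Aₖ`. -/
def IsCondSetSeq (O : (Ω →ₘ[μ] ℕ) → Set (Ω →ₘ[μ] E)) : Prop :=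
  ∀ A : ℕ → Set Ω, IsPartition μ A → ∀ (i : ℕ → (Ω →ₘ[μ] ℕ)) (j : Ω →ₘ[μ] ℕ),
    IsConcat A i j → O j = setConcat A (fun k => O (i k))

/-- `κ` is strictly increasing on `D`, evaluated conditionally: `κ i < κ j` on `{i < j}`. -/
def CondStrictMonoOn (D : Set (Ω →ₘ[μ] ℕ)) (κ : (Ω →ₘ[μ] ℕ) → (Ω →ₘ[μ] ℕ)) : Prop :=
  ∀ i ∈ D, ∀ j ∈ D, ∀ᵐ ω ∂μ, i ω < j ω → κ i ω < κ j ω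

/-- `C` is the union (the supremum) of the family `𝒢` of measurable sets in the quotient of the
σ-algebra by the null sets. -/
def IsEssUnion (μ : Measure Ω) (𝒢 : Set (Set Ω)) (C : Set Ω) : Prop :=
  MeasurableSet C ∧ (∀ G ∈ 𝒢, G ≤ᵐ[μ] C) ∧
    ∀ D : Set Ω, MeasurableSet D → (∀ G ∈ 𝒢, G ≤ᵐ[μ] D) → C ≤ᵐ[μ] D

/-- The conditional union `⊔ᵢ Oᵢ`: all `x` such that the sets `B` on which `x|B` belongs to some
`Oᵢ|B` have union `Ω`. -/
def condUnion {ι : Type*} (O : ι → Set (Ω →ₘ[μ] E)) : Set (Ω →ₘ[μ] E) :=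
  {x | IsEssUnion μ {B | MeasurableSet B ∧ ∃ i, ∃ y ∈ O i, EqOnSet B x y} Set.univ}

/-- The set of almost everywhere selections of a set-valued map. -/
def aeSelections (μ : Measure Ω) (X : Ω → Set E) : Set (Ω →ₘ[μ] E) :=
  {x | ∀ᵐ ω ∂μ, x ω ∈ X ω}

/-- Effros measurability of a set-valued map. -/
def IsEffrosMeasurable (X : Ω → Set E) : Prop :=
  ∀ U : Set E, IsOpen U → MeasurableSet {ω | (X ω ∩ U).Nonempty}

end General

section Euclidean

variable {Ω : Type*} [MeasurableSpace Ω] {μ : Measure Ω}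

/-- The conditional Euclidean space `L⁰(ℝ)ⁿ` for `n ∈ L⁰(ℕ)`: (classes of) measurable maps `x`
with `x ω ∈ ℝ^(n ω)` almost everywhere. -/
def condEuc (n : Ω →ₘ[μ] ℕ) : Set (Ω →ₘ[μ] EucVec) :=
  {x | ∀ᵐ ω ∂μ, (x ω).1 = n ω}

/-- `L⁰(ℚ)ⁿ` as a subset of `L⁰(ℝ)ⁿ`. -/
def condRatEuc (n : Ω →ₘ[μ] ℕ) : Set (Ω →ₘ[μ] EucVec) :=
  {x | x ∈ condEuc n ∧ ∀ᵐ ω ∂μ, ∀ m : Fin (x ω).1, ∃ a : ℚ, (x ω).2 m = (a : ℝ)}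

/-- `L⁰₊₊(ℚ)`. -/
def posRat (μ : Measure Ω) : Set (Ω →ₘ[μ] ℚ) :=
  {r | ∀ᵐ ω ∂μ, 0 < r ω}

/-- The open ball `B(q, r)` in `L⁰(ℝ)ⁿ`. -/
def condBall (n : Ω →ₘ[μ] ℕ) (q : Ω →ₘ[μ] EucVec) (r : Ω →ₘ[μ] ℚ) : Set (Ω →ₘ[μ] EucVec) :=
  {x | x ∈ condEuc n ∧ ∀ᵐ ω ∂μ, eucDist (x ω) (q ω) < (r ω : ℝ)}

/-- A conditionally open subset of `L⁰(ℝ)ⁿ`: the conditional union of a conditional sequence of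
open balls with centres in `L⁰(ℚ)ⁿ` and radii in `L⁰₊₊(ℚ)`. -/
def IsCondOpen (n : Ω →ₘ[μ] ℕ) (O : Set (Ω →ₘ[μ] EucVec)) : Prop :=
  ∃ (q : (Ω →ₘ[μ] ℕ) → (Ω →ₘ[μ] EucVec)) (r : (Ω →ₘ[μ] ℕ) → (Ω →ₘ[μ] ℚ)),
    IsCondSeq q ∧ IsCondSeq r ∧ (∀ k, q k ∈ condRatEuc n) ∧ (∀ k, r k ∈ posRat μ) ∧
      O = condUnion (fun k => condBall n (q k) (r k))

/-- Conditional convergence of a conditional sequence in `L⁰(ℝ)ⁿ`. -/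
def CondTendsto (x : (Ω →ₘ[μ] ℕ) → (Ω →ₘ[μ] EucVec)) (y : Ω →ₘ[μ] EucVec) : Prop :=
  ∀ r ∈ posRat μ, ∃ m : Ω →ₘ[μ] ℕ, ∀ k : Ω →ₘ[μ] ℕ, (∀ᵐ ω ∂μ, m ω ≤ k ω) →
    ∀ᵐ ω ∂μ, eucDist (x k ω) (y ω) < (r ω : ℝ)

/-- Conditional (sequential) compactness: every conditional sequence in `W` has a conditional
subsequence which converges conditionally to an element of `W`. -/
def IsCondCompact (W : Set (Ω →ₘ[μ] EucVec)) : Prop :=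
  ∀ x : (Ω →ₘ[μ] ℕ) → (Ω →ₘ[μ] EucVec), IsCondSeq x → (∀ k, x k ∈ W) →
    ∃ κ : (Ω →ₘ[μ] ℕ) → (Ω →ₘ[μ] ℕ), IsCondSeq κ ∧ CondStrictMonoOn Set.univ κ ∧
      ∃ y ∈ W, CondTendsto (fun p => x (κ p)) y

/-- The conditional index set `{1 ≤ j ≤ m}`. -/
def condSegment (m : Ω →ₘ[μ] ℕ) : Set (Ω →ₘ[μ] ℕ) :=
  {j | ∀ᵐ ω ∂μ, 1 ≤ j ω ∧ j ω ≤ m ω}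

/-- The conditional Heine–Borel property: every conditional sequence of conditionally open sets
covering `W` has a conditionally finite subsequence `(O_{i j})`, `1 ≤ j ≤ m`, covering `W`. -/
def HasCondHeineBorel (n : Ω →ₘ[μ] ℕ) (W : Set (Ω →ₘ[μ] EucVec)) : Prop :=
  ∀ O : (Ω →ₘ[μ] ℕ) → Set (Ω →ₘ[μ] EucVec), IsCondSetSeq O → (∀ i, IsCondOpen n (O i)) →
    W ⊆ condUnion O →
    ∃ m : Ω →ₘ[μ] ℕ, (∀ᵐ ω ∂μ, 1 ≤ m ω) ∧
      ∃ i : (Ω →ₘ[μ] ℕ) → (Ω →ₘ[μ] ℕ),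
        IsCondFunOn (condSegment m) i ∧ CondStrictMonoOn (condSegment m) i ∧
          W ⊆ condUnion (fun j : condSegment m => O (i j))

/-- The set `∑ₖ Wₖ|Aₖ` where `Wₖ` is a subset of the standard product `L⁰(ℝ)^(d k)`. -/
def eucConcat (A : ℕ → Set Ω) (d : ℕ → ℕ)
    (W : ∀ k, Set (Ω →ₘ[μ] EuclideanSpace ℝ (Fin (d k)))) : Set (Ω →ₘ[μ] EucVec) :=
  {y | ∃ x : ∀ k, Ω →ₘ[μ] EuclideanSpace ℝ (Fin (d k)), (∀ k, x k ∈ W k) ∧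
    ∀ k, ∀ᵐ ω ∂μ, ω ∈ A k → y ω = ⟨d k, x k ω⟩}

end Euclidean

end CondAnalysis

open MeasureTheory

namespace CondAnalysis

open Filter Topology TopologicalSpace

/-! ### Locality, gluing and exhaustion in `L⁰` -/

section Glue

variable {Ω : Type*} [MeasurableSpace Ω] {μ : Measure Ω}
variable {E : Type*} [TopologicalSpace E]

/-! Locality makes everything pointwise. A conditional sequence is determined by its values at
constant indices (`IsCondSeq.ae_eq`), and every ordinary sequence in a stable set glues to a
conditional one (`glue`). Open sets become countable unions of balls at almost every `ω`
(`exists_eq_ballUnions`). Uncountable families in `W` are handled by exhaustion: some element of `W`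
has a given property on the largest possible set (`IsStable.exists_maximal`).

Compact ⇒ Heine–Borel: let `z K ∈ W` avoid the first `K` open sets on the largest possible set. A
subsequence converges to some `y ∈ W`. At `ω` some open set contains `y ω`, hence `z K ω` for some
`K` exceeding its index. By maximality the first `K` sets then cover all of `W` at `ω`, and the
least such `K` is measurable in `ω`.

Heine–Borel ⇒ selections: exhaustion over a countable basis gives a pointwise dense sequence in `W`,
and `X ω` is the closure of its values. Balls about the origin yield boundedness. Balls staying away
from a point `y` of the pointwise closure yield `y ∈ W`.

Selections ⇒ compact: nested thinning of the index set, done measurably in `ω`, produces a pointwise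
convergent subsequence (`exists_measurable_subseq`), and the compact fibres contain the limit. -/

theorem exists_index {P : ℕ → Ω → Prop} (hP : ∀ j, MeasurableSet {ω | P j ω}) :
    ∃ f : Ω →ₘ[μ] ℕ, ∀ᵐ ω ∂μ, (∃ j, P j ω) → P (f ω) ω ∧ ∀ j < f ω, ¬ P j ω := by
  classical
  -- The second disjunct makes the search total; it returns `0` where no `j` works.
  have hex : ∀ ω, ∃ j, P j ω ∨ ∀ i, ¬ P i ω := fun ω => by
    by_cases h : ∃ j, P j ω
    · exact h.imp fun j hj => Or.inl hj
    · exact ⟨0, Or.inr fun i hi => h ⟨i, hi⟩⟩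
  have hm : Measurable fun ω => Nat.find (hex ω) := by
    refine measurable_find hex fun k => ?_
    refine MeasurableSet.union (hP k) (?_ : MeasurableSet {ω | ∀ i, ¬ P i ω})
    have : {ω | ∀ i, ¬ P i ω} = ⋂ i, {ω | P i ω}ᶜ := by ext; simp
    rw [this]
    exact MeasurableSet.iInter fun i => (hP i).compl
  refine ⟨AEEqFun.mk _ hm.stronglyMeasurable.aestronglyMeasurable, ?_⟩
  filter_upwards [AEEqFun.coeFn_mk (μ := μ) _ hm.stronglyMeasurable.aestronglyMeasurable]
    with ω hω hj
  rw [hω]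
  refine ⟨?_, fun j hj' hPj => Nat.find_min (hex ω) hj' (Or.inl hPj)⟩
  rcases Nat.find_spec (hex ω) with h | h
  · exact h
  · exact absurd hj (by simpa using h)

theorem IsPartition.of_index (i : Ω →ₘ[μ] ℕ) : IsPartition μ (fun k => {ω | i ω = k}) := by
  refine ⟨fun k => i.measurable (measurableSet_singleton k), fun k l hkl => ?_, ?_⟩
  · have : {ω | i ω = k} ∩ {ω | i ω = l} = ∅ := by
      ext ω
      simp only [Set.mem_inter_iff, Set.mem_ofPred_eq, Set.mem_empty_iff_false, iff_false]
      rintro ⟨rfl, h⟩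
      exact hkl h
    simp [this]
  · exact Eventually.of_forall fun ω => by simp

/-- Stability is applied to the partition `{i = k}`, on whose members `i` is constant. -/
theorem IsCondSeq.ae_eq {f : (Ω →ₘ[μ] ℕ) → (Ω →ₘ[μ] E)} (hf : IsCondSeq f)
    (i : Ω →ₘ[μ] ℕ) : ∀ᵐ ω ∂μ, f i ω = f (AEEqFun.const Ω (i ω)) ω := by
  have h := hf _ (IsPartition.of_index i) (fun k => AEEqFun.const Ω k) (fun _ => trivial) i trivial
    (fun k => by
      filter_upwards [AEEqFun.coeFn_const (μ := μ) Ω k] with ω hω hi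
      rw [hω]; exact hi)
  filter_upwards [ae_all_iff.2 h] with ω hω
  exact hω (i ω) rfl

theorem const_ae (b : E) : ∀ᵐ ω ∂μ, (AEEqFun.const Ω b : Ω →ₘ[μ] E) ω = b :=
  AEEqFun.coeFn_const Ω b

theorem IsCondFunOn.mono {F : Type*} [TopologicalSpace F] {D D' : Set (Ω →ₘ[μ] E)}
    {f : (Ω →ₘ[μ] E) → (Ω →ₘ[μ] F)} (hf : IsCondFunOn D f) (h : D' ⊆ D) : IsCondFunOn D' f :=
  fun A hA x hx y hy hxy => hf A hA x (fun k => h (hx k)) y (h hy) hxy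

variable [PseudoMetrizableSpace E] [SecondCountableTopology E]

theorem stronglyMeasurable_glue (x : ℕ → (Ω →ₘ[μ] E)) (i : Ω →ₘ[μ] ℕ) :
    StronglyMeasurable fun ω => x (i ω) ω := by
  borelize E
  have h : Measurable fun p : ℕ × Ω => x p.1 p.2 :=
    measurable_from_prod_countable_right fun k => (x k).measurable
  exact (h.comp (i.measurable.prodMk measurable_id)).stronglyMeasurable

/-- The function whose value at `ω` is `x k ω` with `k = i ω`. -/
noncomputable def glue (x : ℕ → (Ω →ₘ[μ] E)) (i : Ω →ₘ[μ] ℕ) : Ω →ₘ[μ] E :=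
  AEEqFun.mk _ (stronglyMeasurable_glue x i).aestronglyMeasurable

theorem glue_ae (x : ℕ → (Ω →ₘ[μ] E)) (i : Ω →ₘ[μ] ℕ) :
    ∀ᵐ ω ∂μ, glue x i ω = x (i ω) ω :=
  AEEqFun.coeFn_mk _ _

theorem glue_const (x : ℕ → (Ω →ₘ[μ] E)) (k : ℕ) : glue x (AEEqFun.const Ω k) = x k := by
  refine AEEqFun.ext ?_
  filter_upwards [glue_ae x (AEEqFun.const Ω k), const_ae (Ω := Ω) (μ := μ) k] with ω h h'
  rw [h, h']

theorem isCondSeq_glue (x : ℕ → (Ω →ₘ[μ] E)) : IsCondSeq (glue x) := by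
  intro A _ i _ j _ hij k
  filter_upwards [hij k, glue_ae x (i k), glue_ae x j] with ω h h1 h2 hA
  rw [h1, h2, h hA]

theorem IsStable.glue_mem {W : Set (Ω →ₘ[μ] E)} (hW : IsStable W) {x : ℕ → (Ω →ₘ[μ] E)}
    (hx : ∀ k, x k ∈ W) (i : Ω →ₘ[μ] ℕ) : glue x i ∈ W := by
  refine hW.2 _ (IsPartition.of_index i) x hx _ fun k => ?_
  filter_upwards [glue_ae x i] with ω h hi
  rw [h, show i ω = k from hi]

/-- A gluing along a measurable set. -/
theorem IsStable.exists_ite {W : Set (Ω →ₘ[μ] E)} (hW : IsStable W) {x y : Ω →ₘ[μ] E}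
    (hx : x ∈ W) (hy : y ∈ W) {B : Set Ω} (hB : MeasurableSet B) :
    ∃ z ∈ W, (∀ᵐ ω ∂μ, ω ∈ B → z ω = x ω) ∧ ∀ᵐ ω ∂μ, ω ∉ B → z ω = y ω := by
  classical
  have hm : Measurable fun ω => if ω ∈ B then 0 else 1 :=
    Measurable.ite hB measurable_const measurable_const
  have hf := AEEqFun.coeFn_mk (μ := μ) _ hm.stronglyMeasurable.aestronglyMeasurable
  set f := AEEqFun.mk (μ := μ) _ hm.stronglyMeasurable.aestronglyMeasurable
  refine ⟨glue (fun k => if k = 0 then x else y) f, hW.glue_mem (fun k => ?_) f, ?_, ?_⟩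
  · split_ifs; exacts [hx, hy]
  all_goals
    filter_upwards [glue_ae (fun k => if k = 0 then x else y) f, hf] with ω h1 h2 hB
    rw [h1, h2]
    simp [hB]

/-- A stable set contains an element which has a given property on the largest possible set. -/
theorem IsStable.exists_maximal [SigmaFinite μ] {W : Set (Ω →ₘ[μ] E)} (hW : IsStable W)
    {P : Ω → E → Prop} (hP : ∀ x : Ω →ₘ[μ] E, MeasurableSet {ω | P ω (x ω)}) :
    ∃ z ∈ W, ∀ x ∈ W, ∀ᵐ ω ∂μ, P ω (x ω) → P ω (z ω) := by
  obtain ⟨w, hw⟩ := hW.1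
  -- A finite measure with the same null sets: its values can be compared and maximised.
  set ν := μ.toFinite
  have hν : ∀ {p : Ω → Prop}, (∀ᵐ ω ∂ν, p ω) ↔ ∀ᵐ ω ∂μ, p ω := by
    intro p; rw [← ae_toFinite (μ := μ)]
  let φ : (Ω →ₘ[μ] E) → ENNReal := fun x => ν {ω | P ω (x ω)}
  have hne : (φ '' W).Nonempty := ⟨_, w, hw, rfl⟩
  obtain ⟨u, -, hu, huW⟩ := exists_seq_tendsto_sSup hne (OrderTop.bddAbove _)
  choose x hxW hxu using huW
  obtain ⟨i, hi⟩ := exists_index (μ := μ) (P := fun k ω => P ω (x k ω)) fun k => hP (x k)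
  have hz := hW.glue_mem hxW i
  set z := glue x i
  have hzP : ∀ k, ∀ᵐ ω ∂μ, P ω (x k ω) → P ω (z ω) := by
    intro k
    filter_upwards [hi, glue_ae x i] with ω h h' hk
    rw [h']
    exact (h ⟨k, hk⟩).1
  have hsup : ∀ y ∈ W, φ y ≤ φ z := by
    intro y hy
    refine (le_sSup (Set.mem_image_of_mem φ hy)).trans (le_of_tendsto' hu fun k => ?_)
    rw [← hxu k]
    exact measure_mono_ae (hν.2 (hzP k))
  refine ⟨z, hz, fun y hy => ?_⟩
  -- `v` has the property wherever `z` or `y` has it, so the maximality of `φ z` makes the gain over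
  -- `z` null.
  obtain ⟨v, hv, hv1, hv2⟩ := hW.exists_ite hz hy (hP z)
  have h1 : ({ω | P ω (z ω)} ∪ {ω | P ω (y ω)} : Set Ω) ≤ᵐ[ν] ({ω | P ω (v ω)} : Set Ω) := by
    refine hν.2 ?_
    filter_upwards [hv1, hv2] with ω h1 h2 h
    by_cases hz : P ω (z ω)
    · change P ω (v ω); rw [h1 hz]; exact hz
    · change P ω (v ω); rw [h2 hz]; exact Or.resolve_left h hz
  have h2 : ({ω | P ω (z ω)} : Set Ω) =ᵐ[ν] ({ω | P ω (z ω)} ∪ {ω | P ω (y ω)} : Set Ω) :=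
    ae_eq_of_subset_of_measure_ge Set.subset_union_left
      ((measure_mono_ae h1).trans (hsup v hv)) (hP z).nullMeasurableSet (measure_ne_top _ _)
  filter_upwards [hν.1 h2.symm.le] with ω h hy
  exact h (Or.inr hy)

end Glue

/-! ### Topology and distance on the sum of Euclidean spaces -/

section EucVec

instance : BorelSpace EucVec := by
  refine ⟨le_antisymm (fun s hs => ?_) (MeasurableSpace.generateFrom_le fun s hs => ?_)⟩
  · have h : s = ⋃ k, Sigma.mk k '' (Sigma.mk k ⁻¹' s) := by
      ext ⟨k, v⟩
      simp only [Set.mem_iUnion, Set.mem_image, Set.mem_preimage]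
      exact ⟨fun h => ⟨k, v, h, rfl⟩, fun ⟨l, w, h, e⟩ => e ▸ h⟩
    rw [h]
    refine @MeasurableSet.iUnion _ _ (borel EucVec) _ _ fun k => ?_
    -- Stated for arbitrary `Y` so that `EucVec` can be given `borel EucVec` instead of its sum
    -- σ-algebra.
    have key : ∀ {Y : Type} [TopologicalSpace Y] [MeasurableSpace Y] [BorelSpace Y]
        {f : EuclideanSpace ℝ (Fin k) → Y} {t : Set _}, IsOpenEmbedding f → MeasurableSet t →
        MeasurableSet (f '' t) := fun hf ht => hf.measurableEmbedding.measurableSet_image' ht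
    exact @key EucVec _ (borel EucVec) (@BorelSpace.mk _ _ (borel EucVec) rfl) _ _
      IsOpenEmbedding.sigmaMk (MeasurableSpace.measurableSet_iInf.1 hs k)
  · exact MeasurableSpace.measurableSet_iInf.2 fun k =>
      (IsOpen.preimage continuous_sigmaMk hs).measurableSet

/-- The value `1` across dimensions does no harm, because the summands are open. -/
theorem continuous_eucDist : Continuous fun p : EucVec × EucVec => eucDist p.1 p.2 := by
  refine continuous_iff_continuousAt.2 ?_
  rintro ⟨⟨k, u⟩, ⟨l, v⟩⟩
  have he : IsOpenEmbedding (Prod.map (Sigma.mk k) (Sigma.mk l) : _ → EucVec × EucVec) :=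
    IsOpenEmbedding.sigmaMk.prodMap IsOpenEmbedding.sigmaMk
  refine (he.continuousAt_iff (x := (u, v))).1 (Continuous.continuousAt ?_)
  by_cases h : k = l
  · subst h
    have : (fun p : EucVec × EucVec => eucDist p.1 p.2) ∘ Prod.map (Sigma.mk k) (Sigma.mk k) =
        fun p => ‖p.1 - p.2‖ := funext fun p => eucDist_mk k p.1 p.2
    rw [this]
    fun_prop
  · have : (fun p : EucVec × EucVec => eucDist p.1 p.2) ∘ Prod.map (Sigma.mk k) (Sigma.mk l) =
        fun _ => 1 := funext fun p => by simp [eucDist, h]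
    rw [this]
    fun_prop

theorem eucDist_self (u : EucVec) : eucDist u u = 0 := by
  obtain ⟨k, u⟩ := u
  simp [eucDist_mk]

theorem eucDist_comm {u v : EucVec} (h : u.1 = v.1) : eucDist u v = eucDist v u := by
  obtain ⟨k, u⟩ := u
  obtain ⟨l, v⟩ := v
  obtain rfl : k = l := h
  simp only [eucDist_mk, norm_sub_rev]

theorem eucDist_triangle {u v w : EucVec} (h : u.1 = v.1) (h' : v.1 = w.1) :
    eucDist u w ≤ eucDist u v + eucDist v w := by
  obtain ⟨k, u⟩ := u
  obtain ⟨l, v⟩ := v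
  obtain ⟨m, w⟩ := w
  obtain rfl : k = l := h
  obtain rfl : k = m := h'
  simp only [eucDist_mk]
  exact norm_sub_le_norm_sub_add_norm_sub _ _ _

theorem eq_of_eucDist_le_zero {u v : EucVec} (h : u.1 = v.1) (h' : eucDist u v ≤ 0) : u = v := by
  obtain ⟨k, u⟩ := u
  obtain ⟨l, v⟩ := v
  obtain rfl : k = l := h
  rw [eucDist_mk, norm_le_zero_iff, sub_eq_zero] at h'
  rw [h']

/-- The vectors with rational coordinates are dense. -/
theorem exists_rat_eucDist_lt (u : EucVec) {ε : ℝ} (hε : 0 < ε) :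
    ∃ a : Fin u.1 → ℚ, eucDist u ⟨u.1, WithLp.toLp 2 fun m => (a m : ℝ)⟩ < ε := by
  obtain ⟨k, u⟩ := u
  have h1 : DenseRange (Pi.map fun (_ : Fin k) (a : ℚ) => (a : ℝ)) :=
    DenseRange.piMap fun _ => Rat.denseRange_cast
  have h2 : DenseRange ((EuclideanSpace.equiv (Fin k) ℝ).symm ∘
      (Pi.map fun (_ : Fin k) (a : ℚ) => (a : ℝ))) :=
    (EuclideanSpace.equiv (Fin k) ℝ).symm.surjective.denseRange.comp h1
      (EuclideanSpace.equiv (Fin k) ℝ).symm.continuous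
  obtain ⟨a, ha⟩ := h2.exists_dist_lt u hε
  exact ⟨a, by rw [eucDist_mk, ← dist_eq_norm]; exact ha⟩

theorem measurable_eucDist {Ω : Type*} [MeasurableSpace Ω] {f g : Ω → EucVec}
    (hf : Measurable f) (hg : Measurable g) : Measurable fun ω => eucDist (f ω) (g ω) :=
  continuous_eucDist.measurable.comp (hf.prodMk hg)

end EucVec

/-! ### Measurable extraction of convergent subsequences -/

section Subsequence

variable {Ω : Type*} [MeasurableSpace Ω] {μ : Measure Ω}

/-- Measurable pigeonhole: among the points of a dense sequence, `f ω` selects the first whose `ε /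
2`-ball is visited infinitely often along `T`. A finite `ε / 4`-net shows that such a point exists.
-/
theorem exists_thinning {E : Type*} [PseudoMetricSpace E] [SecondCountableTopology E]
    (x : ℕ → (Ω →ₘ[μ] E)) {T : ℕ → Ω → Prop} (hT : ∀ k, MeasurableSet {ω | T k ω})
    {ε : ℝ} (hε : 0 < ε) :
    ∃ T' : ℕ → Ω → Prop, (∀ k, MeasurableSet {ω | T' k ω}) ∧ (∀ k ω, T' k ω → T k ω) ∧
      (∀ ω k l, T' k ω → T' l ω → dist (x k ω) (x l ω) < ε) ∧
      ∀ᵐ ω ∂μ, TotallyBounded (Set.range fun k => x k ω) → (∃ᶠ k in atTop, T k ω) →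
        ∃ᶠ k in atTop, T' k ω := by
  borelize E
  rcases isEmpty_or_nonempty Ω with hΩ | ⟨⟨ω₀⟩⟩
  · exact ⟨T, hT, fun _ _ h => h, fun ω => hΩ.elim ω, Eventually.of_forall fun ω => hΩ.elim ω⟩
  have : Nonempty E := ⟨x 0 ω₀⟩
  let Q := denseSeq E
  have hmeas : ∀ (g : Ω → E), Measurable g → ∀ k,
      MeasurableSet {ω | T k ω ∧ dist (x k ω) (g ω) < ε / 2} := fun g hg k =>
    (hT k).inter (measurableSet_lt ((x k).measurable.dist hg) measurable_const)
  obtain ⟨f, hf⟩ := exists_index (μ := μ)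
    (P := fun j ω => ∃ᶠ k in atTop, T k ω ∧ dist (x k ω) (Q j) < ε / 2) fun j => by
      have : {ω | ∃ᶠ k in atTop, T k ω ∧ dist (x k ω) (Q j) < ε / 2} =
          ⋂ N : ℕ, ⋃ k : ℕ, ⋃ _ : N ≤ k, {ω | T k ω ∧ dist (x k ω) (Q j) < ε / 2} := by
        ext ω; simp [frequently_atTop, and_left_comm]
      rw [this]
      exact .iInter fun N => .iUnion fun k => .iUnion fun _ => hmeas _ measurable_const k
  refine ⟨fun k ω => T k ω ∧ dist (x k ω) (Q (f ω)) < ε / 2,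
    hmeas (fun ω => Q (f ω)) (measurable_from_nat.comp f.measurable), fun k ω h => h.1,
    fun ω k l h h' => ?_, ?_⟩
  · have := dist_triangle_right (x k ω) (x l ω) (Q (f ω))
    linarith [h.2, h'.2]
  · filter_upwards [hf] with ω hω htb hfr
    refine (hω ?_).1
    obtain ⟨t, ht, hcov⟩ := Metric.totallyBounded_iff.1 htb (ε / 4) (by positivity)
    have h1 : ∃ᶠ k in atTop, ∃ y ∈ t, T k ω ∧ dist (x k ω) y < ε / 4 := by
      refine hfr.mono fun k hk => ?_
      have := hcov (Set.mem_range_self k)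
      simp only [Set.mem_iUnion, Metric.mem_ball] at this
      obtain ⟨y, hy, h⟩ := this
      exact ⟨y, hy, hk, h⟩
    obtain ⟨y, -, hy⟩ : ∃ y ∈ t, ∃ᶠ k in atTop, T k ω ∧ dist (x k ω) y < ε / 4 := by
      by_contra hcon
      have hcon : ∀ y ∈ t, ∀ᶠ k in atTop, ¬ (T k ω ∧ dist (x k ω) y < ε / 4) :=
        fun y hy => not_frequently.1 fun h => hcon ⟨y, hy, h⟩
      refine h1 ?_
      filter_upwards [(eventually_all_finite ht).2 hcon] with k hk
      rintro ⟨y, hy, h⟩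
      exact hk y hy h
    obtain ⟨j, hj⟩ := (denseRange_denseSeq E).exists_dist_lt y (show 0 < ε / 4 by positivity)
    refine ⟨j, hy.mono fun k hk => ⟨hk.1, ?_⟩⟩
    have := dist_triangle (x k ω) y (Q j)
    linarith [hk.2]

/-- A measurable choice of a convergent subsequence of a relatively compact sequence. -/
theorem exists_measurable_subseq {E : Type*} [TopologicalSpace E] [PseudoMetrizableSpace E]
    [SecondCountableTopology E] (x : ℕ → (Ω →ₘ[μ] E))
    (hx : ∀ᵐ ω ∂μ, ∃ K, IsCompact K ∧ ∀ k, x k ω ∈ K) :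
    ∃ (κ : ℕ → (Ω →ₘ[μ] ℕ)) (y : Ω →ₘ[μ] E), ∀ᵐ ω ∂μ, StrictMono (fun p => κ p ω) ∧
      Tendsto (fun p => x (κ p ω) ω) atTop (𝓝 (y ω)) := by
  let := pseudoMetrizableSpacePseudoMetric E
  borelize E
  choose F hF1 hF2 hF3 hF4 using fun (T : {T : ℕ → Ω → Prop // ∀ k, MeasurableSet {ω | T k ω}})
    (m : ℕ) => exists_thinning (μ := μ) x T.2 (show (0 : ℝ) < (1 / 2) ^ m by positivity)
  let T : ℕ → {T : ℕ → Ω → Prop // ∀ k, MeasurableSet {ω | T k ω}} := fun m =>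
    Nat.rec ⟨fun _ _ => True, fun _ => MeasurableSet.const _⟩ (fun m T => ⟨F T m, hF1 T m⟩) m
  have hTanti : ∀ ω k, Antitone fun m => (T m).1 k ω := fun ω k =>
    antitone_nat_of_succ_le fun m => hF2 (T m) m k ω
  have hTfreq : ∀ᵐ ω ∂μ, ∀ m, ∃ᶠ k in atTop, (T m).1 k ω := by
    filter_upwards [hx, ae_all_iff.2 fun m => hF4 (T m) m] with ω ⟨K, hK, hxK⟩ h m
    induction m with
    | zero => exact Eventually.frequently (Eventually.of_forall fun k => trivial)
    | succ m ih =>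
      exact h m (hK.totallyBounded.subset (Set.range_subset_iff.2 hxK)) ih
  choose G hG using fun (κ : Ω →ₘ[μ] ℕ) (m : ℕ) => exists_index (μ := μ)
    (P := fun k ω => κ ω < k ∧ (T m).1 k ω) fun k =>
      (measurableSet_lt κ.measurable measurable_const).inter ((T m).2 k)
  -- Diagonal choice: `κ (p + 1)` is the first index in `T (p + 1)` beyond `κ p`.
  let κ : ℕ → (Ω →ₘ[μ] ℕ) := fun p =>
    Nat.rec (AEEqFun.const Ω 0) (fun p κ => G κ (p + 1)) p
  have hκ : ∀ᵐ ω ∂μ, ∀ p, κ p ω < κ (p + 1) ω ∧ (T (p + 1)).1 (κ (p + 1) ω) ω := by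
    filter_upwards [hTfreq, ae_all_iff.2 fun p => hG (κ p) (p + 1)] with ω h1 h2 p
    refine (h2 p ?_).1
    obtain ⟨k, hk, hk'⟩ := frequently_atTop.1 (h1 (p + 1)) (κ p ω + 1)
    exact ⟨k, hk, hk'⟩
  have hconv : ∀ᵐ ω ∂μ, ∃ l, Tendsto (fun p => glue x (κ p) ω) atTop (𝓝 l) := by
    filter_upwards [hκ, hx, ae_all_iff.2 fun p => glue_ae x (κ p)] with ω h1 ⟨K, hK, hxK⟩ h2
    simp only [h2]
    have hc : CauchySeq fun p => x (κ p ω) ω := by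
      refine Metric.cauchySeq_iff.2 fun ε hε => ?_
      obtain ⟨m, hm⟩ := exists_pow_lt_of_lt_one hε (show (1 / 2 : ℝ) < 1 by norm_num)
      have hmem : ∀ p ≥ m + 1, (T (m + 1)).1 (κ p ω) ω := fun p hp => by
        obtain ⟨q, rfl⟩ : ∃ q, p = q + 1 := ⟨p - 1, by omega⟩
        exact hTanti ω _ hp (h1 q).2
      exact ⟨m + 1, fun p hp q hq =>
        (hF3 (T m) m ω _ _ (hmem p hp) (hmem q hq)).trans hm⟩
    obtain ⟨l, -, hl⟩ := cauchySeq_tendsto_of_isComplete hK.isComplete (fun p => hxK _) hc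
    exact ⟨l, hl⟩
  obtain ⟨y, hy, hlim⟩ := measurable_limit_of_tendsto_metrizable_ae
    (fun p => (glue x (κ p)).measurable.aemeasurable) hconv
  refine ⟨κ, AEEqFun.mk y hy.stronglyMeasurable.aestronglyMeasurable, ?_⟩
  filter_upwards [hκ, hlim, ae_all_iff.2 fun p => glue_ae x (κ p),
    AEEqFun.coeFn_mk (μ := μ) y hy.stronglyMeasurable.aestronglyMeasurable] with ω h1 h2 h3 h4
  refine ⟨strictMono_nat_of_lt_succ fun p => (h1 p).1, ?_⟩
  rw [h4]
  simpa only [h3] using h2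

end Subsequence

/-! ### Conditional unions and locality of stable functions -/

section CondUnion

variable {Ω : Type*} [MeasurableSpace Ω] {μ : Measure Ω}
variable {E F : Type*} [TopologicalSpace E] [TopologicalSpace F]

/-- The set where `x` satisfies `P` bounds every `B` in the defining family, and `Ω` is the least
such bound. -/
theorem ae_of_mem_condUnion {ι : Type*} {O : ι → Set (Ω →ₘ[μ] E)} {x : Ω →ₘ[μ] E}
    (hx : x ∈ condUnion O) {P : Ω → E → Prop} (hP : MeasurableSet {ω | P ω (x ω)})
    (h : ∀ i, ∀ y ∈ O i, ∀ᵐ ω ∂μ, P ω (y ω)) : ∀ᵐ ω ∂μ, P ω (x ω) := by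
  have h1 : Set.univ ≤ᵐ[μ] {ω | P ω (x ω)} := by
    refine hx.2.2 _ hP ?_
    rintro G ⟨-, i, y, hy, he⟩
    filter_upwards [h i y hy, he] with ω h1 h2 hG
    change P ω (x ω)
    rw [h2 hG]
    exact h1
  filter_upwards [h1] with ω hω
  exact hω trivial

theorem mem_condUnion_of_mem {ι : Type*} {O : ι → Set (Ω →ₘ[μ] E)} {x : Ω →ₘ[μ] E} {i : ι}
    (hx : x ∈ O i) : x ∈ condUnion O :=
  ⟨MeasurableSet.univ, fun _ _ => Eventually.of_forall fun _ _ => trivial, fun _ _ h =>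
    h _ ⟨MeasurableSet.univ, i, x, hx, Eventually.of_forall fun _ _ => rfl⟩⟩

theorem isStable_univ (x : Ω →ₘ[μ] E) : IsStable (Set.univ : Set (Ω →ₘ[μ] E)) :=
  ⟨⟨x, trivial⟩, fun _ _ _ _ _ _ => trivial⟩

/-- Locality on a domain that need not contain the constants, such as `condSegment m`: `y` is the
concatenation of `x` on `{x = y}` and `y` elsewhere. -/
theorem IsCondFunOn.ae_congr {D : Set (Ω →ₘ[μ] ℕ)} {f : (Ω →ₘ[μ] ℕ) → (Ω →ₘ[μ] F)}
    (hf : IsCondFunOn D f) {x y : Ω →ₘ[μ] ℕ} (hx : x ∈ D) (hy : y ∈ D) :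
    ∀ᵐ ω ∂μ, x ω = y ω → f x ω = f y ω := by
  obtain ⟨i, hi⟩ := exists_index (μ := μ) (P := fun k ω => (k = 0 ∧ x ω = y ω) ∨ k = 1) fun k =>
    ((MeasurableSet.const _).inter (measurableSet_eq_fun x.measurable y.measurable)).union
      (MeasurableSet.const _)
  have h := hf _ (IsPartition.of_index i) (fun k => if k = 0 then x else y)
    (fun k => by split_ifs; exacts [hx, hy]) y hy fun k => by
      filter_upwards [hi] with ω h hk
      split_ifs with hk0
      · have := (h ⟨1, Or.inr rfl⟩).1
        rw [show i ω = k from hk, hk0] at this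
        exact (this.resolve_right (by simp)).2.symm
      · rfl
  filter_upwards [hi, h 0] with ω h1 h2 hxy
  refine (h2 ?_).symm
  by_contra hne
  exact (h1 ⟨1, Or.inr rfl⟩).2 0 (Nat.pos_of_ne_zero hne) (Or.inl ⟨rfl, hxy⟩)

theorem setConcat_congr {A : ℕ → Set Ω} {V W : ℕ → Set (Ω →ₘ[μ] E)} (h : ∀ k, V k = W k) :
    setConcat A V = setConcat A W := by
  rw [funext h]

theorem IsCondSetSeq.ext {O O' : (Ω →ₘ[μ] ℕ) → Set (Ω →ₘ[μ] E)} (hO : IsCondSetSeq O)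
    (hO' : IsCondSetSeq O')
    (h : ∀ k : ℕ, O (AEEqFun.const Ω k) = O' (AEEqFun.const Ω k)) : O = O' := by
  funext i
  have hi : IsConcat (fun k => {ω | i ω = k}) (fun k => AEEqFun.const Ω k) i := fun k => by
    filter_upwards [const_ae (Ω := Ω) (μ := μ) k] with ω h hk
    rw [h]; exact hk
  rw [hO _ (IsPartition.of_index i) _ i hi, hO' _ (IsPartition.of_index i) _ i hi]
  exact setConcat_congr h

end CondUnion

/-! ### Open sets and covers as pointwise unions of balls -/

section Covers

variable {Ω : Type*} [MeasurableSpace Ω] {μ : Measure Ω}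

/-- The vector `v` belongs to one of the balls `B(q j ω, r j ω)`. -/
def Covered (q : ℕ → (Ω →ₘ[μ] EucVec)) (r : ℕ → (Ω →ₘ[μ] ℚ)) (ω : Ω) (v : EucVec) : Prop :=
  ∃ j, eucDist v (q j ω) < (r j ω : ℝ)

theorem measurableSet_covered (q : ℕ → (Ω →ₘ[μ] EucVec)) (r : ℕ → (Ω →ₘ[μ] ℚ))
    (x : Ω →ₘ[μ] EucVec) : MeasurableSet {ω | Covered q r ω (x ω)} := by
  have : {ω | Covered q r ω (x ω)} = ⋃ j, {ω | eucDist (x ω) (q j ω) < (r j ω : ℝ)} := by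
    ext; simp [Covered]
  rw [this]
  exact .iUnion fun j => measurableSet_lt (measurable_eucDist x.measurable (q j).measurable)
    (Rat.continuous_coe_real.measurable.comp (r j).measurable)

theorem measurableSet_fst_eq (n : Ω →ₘ[μ] ℕ) (x : Ω →ₘ[μ] EucVec) :
    MeasurableSet {ω | (x ω).1 = n ω} := by
  refine measurableSet_eq_fun (Measurable.comp (g := Sigma.fst) ?_ x.measurable) n.measurable
  exact (continuous_sigma fun k => continuous_const).measurable

/-- A conditional union of balls consists of the functions with values in the pointwise unions. -/
theorem condUnion_condBall {n : Ω →ₘ[μ] ℕ} {q : (Ω →ₘ[μ] ℕ) → (Ω →ₘ[μ] EucVec)}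
    {r : (Ω →ₘ[μ] ℕ) → (Ω →ₘ[μ] ℚ)} (hq : IsCondSeq q) (hr : IsCondSeq r) :
    condUnion (fun k => condBall n (q k) (r k)) =
      {x | x ∈ condEuc n ∧ ∀ᵐ ω ∂μ, Covered (fun j => q (AEEqFun.const Ω j))
        (fun j => r (AEEqFun.const Ω j)) ω (x ω)} := by
  ext x
  constructor
  · intro hx
    refine ⟨ae_of_mem_condUnion (P := fun ω v => v.1 = n ω) hx (measurableSet_fst_eq n x)
      fun i y hy => hy.1, ae_of_mem_condUnion hx (measurableSet_covered _ _ x) fun k y hy => ?_⟩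
    filter_upwards [hy.2, hq.ae_eq k, hr.ae_eq k] with ω h h1 h2
    exact ⟨k ω, by rwa [← h1, ← h2]⟩
  · rintro ⟨hx, hc⟩
    obtain ⟨k, hk⟩ := exists_index (μ := μ) (P := fun j ω =>
      eucDist (x ω) (q (AEEqFun.const Ω j) ω) < (r (AEEqFun.const Ω j) ω : ℝ)) fun j =>
      measurableSet_lt (measurable_eucDist x.measurable (q _).measurable)
        (Rat.continuous_coe_real.measurable.comp (r _).measurable)
    refine mem_condUnion_of_mem (i := k) ⟨hx, ?_⟩
    filter_upwards [hc, hk, hq.ae_eq k, hr.ae_eq k] with ω h h0 h1 h2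
    rw [h1, h2]
    exact (h0 h).1

/-- The conditional sequence of open sets which is generated by countably many sequences of
balls. -/
def ballUnions (n : Ω →ₘ[μ] ℕ) (q : ℕ → ℕ → (Ω →ₘ[μ] EucVec)) (r : ℕ → ℕ → (Ω →ₘ[μ] ℚ))
    (i : Ω →ₘ[μ] ℕ) : Set (Ω →ₘ[μ] EucVec) :=
  {x | x ∈ condEuc n ∧ ∀ᵐ ω ∂μ, Covered (q (i ω)) (r (i ω)) ω (x ω)}

variable {n : Ω →ₘ[μ] ℕ} {q : ℕ → ℕ → (Ω →ₘ[μ] EucVec)} {r : ℕ → ℕ → (Ω →ₘ[μ] ℚ)}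

/-- The centre of the first ball is an element defined on all of `Ω`; it serves to extend pieces
`y|Aₖ` in `isCondSetSeq_ballUnions`. -/
theorem glue_mem_ballUnions (hq : ∀ i j, q i j ∈ condRatEuc n) (hr : ∀ i j, r i j ∈ posRat μ)
    (i : Ω →ₘ[μ] ℕ) : glue (fun l => q l 0) i ∈ ballUnions n q r i := by
  constructor
  · filter_upwards [glue_ae (fun l => q l 0) i, ae_all_iff.2 fun l => (hq l 0).1] with ω h h'
    rw [h]; exact h' _
  · filter_upwards [glue_ae (fun l => q l 0) i, ae_all_iff.2 fun l => hr l 0] with ω h h'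
    refine ⟨0, ?_⟩
    rw [h, eucDist_self]
    exact_mod_cast h' (i ω)

theorem isCondSetSeq_ballUnions (hq : ∀ i j, q i j ∈ condRatEuc n)
    (hr : ∀ i j, r i j ∈ posRat μ) : IsCondSetSeq (ballUnions n q r) := by
  intro A hA i j hij
  ext y
  constructor
  · intro hy
    choose z _ hz1 hz2 using fun k => (isStable_univ y).exists_ite (Set.mem_univ y)
      (Set.mem_univ (glue (fun l => q l 0) (i k))) (hA.1 k)
    refine ⟨z, fun k => ⟨?_, ?_⟩, fun k => ?_⟩
    · change ∀ᵐ ω ∂μ, (z k ω).1 = n ω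
      filter_upwards [hz1 k, hz2 k, hy.1, (glue_mem_ballUnions hq hr (i k)).1] with ω h1 h2 h3 h4
      by_cases hω : ω ∈ A k
      · rw [h1 hω]; exact h3
      · rw [h2 hω]; exact h4
    · filter_upwards [hz1 k, hz2 k, hy.2, (glue_mem_ballUnions hq hr (i k)).2, hij k]
        with ω h1 h2 h3 h4 h5
      by_cases hω : ω ∈ A k
      · rw [h1 hω, ← h5 hω]; exact h3
      · rw [h2 hω]; exact h4
    · filter_upwards [hz1 k] with ω h hω
      exact (h hω).symm
  · rintro ⟨x, hx, hxy⟩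
    constructor
    · filter_upwards [hA.2.2, ae_all_iff.2 hxy, ae_all_iff.2 fun k => (hx k).1] with ω h h1 h2
      obtain ⟨k, hk⟩ := Set.mem_iUnion.1 h
      rw [h1 k hk]; exact h2 k
    · filter_upwards [hA.2.2, ae_all_iff.2 hxy, ae_all_iff.2 fun k => (hx k).2, ae_all_iff.2 hij]
        with ω h h1 h2 h3
      obtain ⟨k, hk⟩ := Set.mem_iUnion.1 h
      rw [h1 k hk, h3 k hk]; exact h2 k

theorem isCondOpen_ballUnions (hq : ∀ i j, q i j ∈ condRatEuc n)
    (hr : ∀ i j, r i j ∈ posRat μ) (i : Ω →ₘ[μ] ℕ) : IsCondOpen n (ballUnions n q r i) := by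
  have h1 := fun j => glue_ae (fun l => q l j) i
  have h2 := fun j => glue_ae (fun l => r l j) i
  refine ⟨glue fun j => glue (fun l => q l j) i, glue fun j => glue (fun l => r l j) i,
    isCondSeq_glue _, isCondSeq_glue _, fun k => ⟨?_, ?_⟩, fun k => ?_, ?_⟩
  · filter_upwards [glue_ae (fun j => glue (fun l => q l j) i) k, ae_all_iff.2 h1,
      ae_all_iff.2 fun l => ae_all_iff.2 fun j => (hq l j).1] with ω h h' h''
    rw [h, h']; exact h'' _ _
  · filter_upwards [glue_ae (fun j => glue (fun l => q l j) i) k, ae_all_iff.2 h1,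
      ae_all_iff.2 fun l => ae_all_iff.2 fun j => (hq l j).2] with ω h h' h''
    rw [h, h']; exact h'' _ _
  · filter_upwards [glue_ae (fun j => glue (fun l => r l j) i) k, ae_all_iff.2 h2,
      ae_all_iff.2 fun l => ae_all_iff.2 fun j => hr l j] with ω h h' h''
    rw [h, h']; exact h'' _ _
  · rw [condUnion_condBall (isCondSeq_glue _) (isCondSeq_glue _)]
    simp only [glue_const]
    ext x
    refine and_congr_right fun _ => eventually_congr ?_
    filter_upwards [ae_all_iff.2 h1, ae_all_iff.2 h2] with ω h h'
    simp only [Covered, h, h']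

/-- Every conditional sequence of open sets is generated by countably many sequences of balls. -/
theorem exists_eq_ballUnions {O : (Ω →ₘ[μ] ℕ) → Set (Ω →ₘ[μ] EucVec)} (hO : IsCondSetSeq O)
    (hopen : ∀ i, IsCondOpen n (O i)) :
    ∃ (q : ℕ → ℕ → (Ω →ₘ[μ] EucVec)) (r : ℕ → ℕ → (Ω →ₘ[μ] ℚ)),
      (∀ i j, q i j ∈ condRatEuc n) ∧ (∀ i j, r i j ∈ posRat μ) ∧ O = ballUnions n q r := by
  choose Q R hQ hR hQn hRp hQR using fun k : ℕ => hopen (AEEqFun.const Ω k)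
  refine ⟨fun i j => Q i (AEEqFun.const Ω j), fun i j => R i (AEEqFun.const Ω j),
    fun i j => hQn i _, fun i j => hRp i _,
    hO.ext (isCondSetSeq_ballUnions (fun i j => hQn i _) fun i j => hRp i _) fun k => ?_⟩
  rw [hQR, condUnion_condBall (hQ k) (hR k)]
  ext x
  refine and_congr_right fun _ => eventually_congr ?_
  filter_upwards [const_ae (Ω := Ω) (μ := μ) k] with ω h
  rw [h]

theorem exists_mem_ballUnions {x : Ω →ₘ[μ] EucVec} (hx : x ∈ condEuc n) {p : ℕ → Ω → Prop}
    (hp : ∀ k, MeasurableSet {ω | p k ω})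
    (h : ∀ᵐ ω ∂μ, ∃ k, p k ω ∧ Covered (q k) (r k) ω (x ω)) :
    ∃ i : Ω →ₘ[μ] ℕ, x ∈ ballUnions n q r i ∧ ∀ᵐ ω ∂μ, p (i ω) ω := by
  obtain ⟨i, hi⟩ := exists_index (μ := μ) (P := fun k ω => p k ω ∧ Covered (q k) (r k) ω (x ω))
    fun k => (hp k).inter (measurableSet_covered _ _ x)
  refine ⟨i, ⟨hx, ?_⟩, ?_⟩
  all_goals filter_upwards [hi, h] with ω h1 h2
  exacts [(h1 h2).1.2, (h1 h2).1.1]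

/-- The Heine–Borel property bounds the number of members of a cover. -/
theorem HasCondHeineBorel.exists_bound {W : Set (Ω →ₘ[μ] EucVec)} (hW : HasCondHeineBorel n W)
    (hWn : W ⊆ condEuc n) (hq : ∀ i j, q i j ∈ condRatEuc n) (hr : ∀ i j, r i j ∈ posRat μ)
    (hc : ∀ x ∈ W, ∀ᵐ ω ∂μ, ∃ i, Covered (q i) (r i) ω (x ω)) :
    ∃ M : Ω →ₘ[μ] ℕ, ∀ x ∈ W, ∀ᵐ ω ∂μ, ∃ i ≤ M ω, Covered (q i) (r i) ω (x ω) := by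
  obtain ⟨m, hm, i, hi, hmono, hcov⟩ := hW _ (isCondSetSeq_ballUnions hq hr)
    (isCondOpen_ballUnions hq hr) fun x hx => by
      obtain ⟨i, hi, -⟩ := exists_mem_ballUnions (p := fun _ _ => True) (hWn hx)
        (fun _ => MeasurableSet.const _) ((hc x hx).mono fun ω h => by simpa using h)
      exact mem_condUnion_of_mem hi
  -- The last index `i m` dominates all `i j`: by strict monotonicity on `{j < m}`, by locality on
  -- `{j = m}`.
  have hmm : m ∈ condSegment m := hm.mono fun ω h => ⟨h, le_rfl⟩
  refine ⟨i m, fun x hx => ae_of_mem_condUnion (P := fun ω v => ∃ k ≤ i m ω,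
    Covered (q k) (r k) ω v) (hcov hx) ?_ ?_⟩
  · have : {ω | ∃ k ≤ i m ω, Covered (q k) (r k) ω (x ω)} =
        ⋃ k, {ω | k ≤ i m ω} ∩ {ω | Covered (q k) (r k) ω (x ω)} := by ext; simp
    rw [this]
    exact .iUnion fun k => (measurableSet_le measurable_const (i m).measurable).inter
      (measurableSet_covered _ _ x)
  · rintro ⟨j, hj⟩ y ⟨-, hy⟩
    filter_upwards [hy, hj, hmono j hj m hmm, hi.ae_congr hj hmm] with ω h h1 h2 h3
    refine ⟨_, ?_, h⟩
    rcases h1.2.lt_or_eq with h4 | h4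
    · exact (h2 h4).le
    · exact (h3 h4).le

end Covers

/-! ### Sequential compactness and the Heine–Borel property -/

section Compactness

variable {Ω : Type*} [MeasurableSpace Ω] {μ : Measure Ω} {n : Ω →ₘ[μ] ℕ}
  {W : Set (Ω →ₘ[μ] EucVec)}

theorem CondTendsto.ae_lt {x : (Ω →ₘ[μ] ℕ) → (Ω →ₘ[μ] EucVec)} {y : Ω →ₘ[μ] EucVec}
    (h : CondTendsto x y) (hx : IsCondSeq x) :
    ∀ᵐ ω ∂μ, ∀ ε > 0, ∃ N : ℕ, ∀ k ≥ N, eucDist (x (AEEqFun.const Ω k) ω) (y ω) < ε := by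
  choose m hm using fun l : ℕ => h (AEEqFun.const Ω (1 / ((l : ℚ) + 1))) (by
    filter_upwards [const_ae (Ω := Ω) (μ := μ) (1 / ((l : ℚ) + 1))] with ω h
    rw [h]; positivity)
  have h1 : ∀ l k, ∀ᵐ ω ∂μ, m l ω ≤ k →
      eucDist (x (AEEqFun.const Ω k) ω) (y ω) < 1 / ((l : ℝ) + 1) := by
    intro l k
    have hs := AEEqFun.coeFn_sup (m l) (AEEqFun.const Ω k)
    have hk := const_ae (Ω := Ω) (μ := μ) k
    -- Convergence only speaks of indices above `m l` everywhere, so `k` is raised to `m l ⊔ k`; the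
    -- two agree on `{m l ≤ k}`.
    filter_upwards [hm l (m l ⊔ AEEqFun.const Ω k) (by
      filter_upwards [hs] with ω h
      rw [h]; exact le_sup_left), hs, hk, hx.ae_eq (m l ⊔ AEEqFun.const Ω k),
      const_ae (Ω := Ω) (μ := μ) (1 / ((l : ℚ) + 1))] with ω h1 h2 h3 h4 h5 hle
    rw [h4, h2, h3, sup_eq_right.2 hle, h5] at h1
    push_cast at h1
    exact h1
  filter_upwards [ae_all_iff.2 fun l => ae_all_iff.2 (h1 l)] with ω hω ε hε
  obtain ⟨l, hl⟩ := exists_nat_one_div_lt hε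
  exact ⟨m l ω, fun k hk => (hω l k hk).trans hl⟩

theorem measurableSet_exists_lt_covered (q : ℕ → ℕ → (Ω →ₘ[μ] EucVec))
    (r : ℕ → ℕ → (Ω →ₘ[μ] ℚ)) (K : ℕ) (x : Ω →ₘ[μ] EucVec) :
    MeasurableSet {ω | ∃ i < K, Covered (q i) (r i) ω (x ω)} := by
  have : {ω | ∃ i < K, Covered (q i) (r i) ω (x ω)} =
      ⋃ i, ⋃ _ : i < K, {ω | Covered (q i) (r i) ω (x ω)} := by ext; simp
  rw [this]
  exact .iUnion fun i => .iUnion fun _ => measurableSet_covered _ _ _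

/-- If the first `K` families cover `z K` at `ω`, then by maximality they cover all of `W` there;
the limit of a subsequence of `z` supplies such a `K`. -/
theorem IsCondCompact.exists_bound [SigmaFinite μ] (hc : IsCondCompact W) (hWn : W ⊆ condEuc n)
    (hW : IsStable W) {q : ℕ → ℕ → (Ω →ₘ[μ] EucVec)} {r : ℕ → ℕ → (Ω →ₘ[μ] ℚ)}
    (hq : ∀ i j, q i j ∈ condRatEuc n)
    (hcov : ∀ x ∈ W, ∀ᵐ ω ∂μ, ∃ i, Covered (q i) (r i) ω (x ω)) :
    ∃ M : Ω →ₘ[μ] ℕ, ∀ x ∈ W, ∀ᵐ ω ∂μ, ∃ i < M ω, Covered (q i) (r i) ω (x ω) := by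
  choose z hz hmax using fun K => hW.exists_maximal
    (P := fun ω v => ¬ ∃ i < K, Covered (q i) (r i) ω v)
    fun x => (measurableSet_exists_lt_covered q r K x).compl
  obtain ⟨κ, hκ, hmono, y, hy, hlim⟩ := hc (glue z) (isCondSeq_glue z) (hW.glue_mem hz)
  have hκm : ∀ᵐ ω ∂μ, ∀ p : ℕ, p ≤ κ (AEEqFun.const Ω p) ω := by
    filter_upwards [ae_all_iff.2 fun p : ℕ => hmono (AEEqFun.const Ω p) trivial
      (AEEqFun.const Ω (p + 1)) trivial, ae_all_iff.2 fun p : ℕ => const_ae (Ω := Ω) (μ := μ) p]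
      with ω h1 h2
    have : StrictMono fun p : ℕ => κ (AEEqFun.const Ω p) ω := strictMono_nat_of_lt_succ fun p =>
      h1 p (by rw [h2, h2]; exact Nat.lt_succ_self p)
    exact fun p => this.le_apply
  have hseq : IsCondSeq fun p => glue z (κ p) := fun A hA x hx y hy hxy =>
    isCondSeq_glue z A hA (fun k => κ (x k)) (fun _ => trivial) _ trivial (hκ A hA x hx y hy hxy)
  have hex : ∀ᵐ ω ∂μ, ∃ K, ∃ i < K, Covered (q i) (r i) ω (z K ω) := by
    filter_upwards [hlim.ae_lt hseq, hcov y hy, hκm, ae_all_iff.2 fun p : ℕ =>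
      glue_ae z (κ (AEEqFun.const Ω p)), hWn hy, ae_all_iff.2 fun K => hWn (hz K),
      ae_all_iff.2 fun i => ae_all_iff.2 fun j => (hq i j).1]
      with ω h1 ⟨i, j, hij⟩ h3 h4 h5 h6 h7
    obtain ⟨N, hN⟩ := h1 _ (sub_pos.2 hij)
    -- As `κ p ≥ p > i`, the family covering `y ω` is among the first `κ p`.
    set p := max N (i + 1)
    have hp := hN p (le_max_left _ _)
    rw [h4] at hp
    refine ⟨κ (AEEqFun.const Ω p) ω, i,
      lt_of_lt_of_le ((Nat.lt_succ_self i).trans_le (le_max_right _ _)) (h3 p), j, ?_⟩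
    have := eucDist_triangle ((h6 (κ (AEEqFun.const Ω p) ω)).trans h5.symm)
      (h5.trans (h7 i j).symm)
    linarith
  obtain ⟨M, hM⟩ := exists_index (μ := μ)
    (P := fun K ω => ∃ i < K, Covered (q i) (r i) ω (z K ω))
    fun K => measurableSet_exists_lt_covered q r K (z K)
  refine ⟨M, fun x hx => ?_⟩
  filter_upwards [hM, hex, ae_all_iff.2 fun K => hmax K x hx] with ω h1 h2 h3
  by_contra h
  exact h3 _ h (h1 h2).1

theorem IsCondCompact.hasCondHeineBorel [SigmaFinite μ] (hc : IsCondCompact W)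
    (hWn : W ⊆ condEuc n) (hW : IsStable W) : HasCondHeineBorel n W := by
  intro O hO hopen hcov
  obtain ⟨q, r, hq, hr, rfl⟩ := exists_eq_ballUnions hO hopen
  obtain ⟨M, hM⟩ := hc.exists_bound hWn hW (q := q) (r := r) hq fun x hx =>
    ae_of_mem_condUnion (P := fun ω v => ∃ i, Covered (q i) (r i) ω v) (hcov hx) (by
      have : {ω | ∃ i, Covered (q i) (r i) ω (x ω)} =
          ⋃ i, {ω | Covered (q i) (r i) ω (x ω)} := by ext; simp
      rw [this]
      exact .iUnion fun i => measurableSet_covered _ _ _) fun i y hy => hy.2.mono fun ω h => ⟨_, h⟩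
  have hM1 : ∀ᵐ ω ∂μ, 1 ≤ M ω := by
    obtain ⟨w, hw⟩ := hW.1
    filter_upwards [hM w hw] with ω h
    obtain ⟨i, hi, -⟩ := h
    omega
  -- Segments start at `1` and the cover at `0`, whence the index `j - 1`; truncation at `j = 0`
  -- never occurs on the segment.
  have hpred := glue_ae (μ := μ) fun j => AEEqFun.const Ω (j - 1)
  have hc := ae_all_iff.2 fun j : ℕ => const_ae (Ω := Ω) (μ := μ) j
  refine ⟨M, hM1, glue fun j => AEEqFun.const Ω (j - 1),
    (isCondSeq_glue _).mono (Set.subset_univ _), fun i hi j hj => ?_, fun x hx => ?_⟩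
  · filter_upwards [hpred i, hpred j, hc, hi, hj] with ω h1 h2 h3 h4 h5 hij
    rw [h1, h2, h3, h3]
    omega
  · obtain ⟨i, hi, hiM⟩ := exists_mem_ballUnions (p := fun k ω => k < M ω) (q := q) (r := r)
      (hWn hx) (fun k => measurableSet_lt measurable_const M.measurable) (hM x hx)
    have hsucc := glue_ae (μ := μ) (fun j => AEEqFun.const Ω (j + 1)) i
    set j := glue (μ := μ) (fun j => AEEqFun.const Ω (j + 1)) i
    have hj : j ∈ condSegment M := by
      filter_upwards [hsucc, hc, hiM] with ω h1 h2 h3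
      rw [h1, h2]
      omega
    have hij : glue (μ := μ) (fun j => AEEqFun.const Ω (j - 1)) j = i := by
      refine AEEqFun.ext ?_
      filter_upwards [hsucc, hc, hpred j] with ω h1 h2 h3
      rw [h3, h2, h1, h2, Nat.add_sub_cancel]
    refine mem_condUnion_of_mem (i := (⟨j, hj⟩ : condSegment M)) ?_
    rw [hij]
    exact hi

/-- A stable set which is closed under almost everywhere limits and whose sequences are almost
everywhere relatively compact is conditionally compact. -/
theorem isCondCompact_of_closed (hW : IsStable W)
    (hcpt : ∀ x : ℕ → (Ω →ₘ[μ] EucVec), (∀ k, x k ∈ W) →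
      ∀ᵐ ω ∂μ, ∃ K, IsCompact K ∧ ∀ k, x k ω ∈ K)
    (hcl : ∀ (x : ℕ → (Ω →ₘ[μ] EucVec)) (y : Ω →ₘ[μ] EucVec), (∀ k, x k ∈ W) →
      (∀ᵐ ω ∂μ, Tendsto (fun k => x k ω) atTop (𝓝 (y ω))) → y ∈ W) : IsCondCompact W := by
  intro x hx hxW
  obtain ⟨κ, y, h⟩ := exists_measurable_subseq (fun k => x (AEEqFun.const Ω k))
    (hcpt _ fun k => hxW _)
  let z := fun p => glue (fun k => x (AEEqFun.const Ω k)) (κ p)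
  have hz := ae_all_iff.2 fun p => glue_ae (fun k => x (AEEqFun.const Ω k)) (κ p)
  have hlim : ∀ᵐ ω ∂μ, Tendsto (fun p => z p ω) atTop (𝓝 (y ω)) := by
    filter_upwards [h, hz] with ω h1 h2
    simpa only [z, h2] using h1.2
  refine ⟨glue κ, isCondSeq_glue κ, fun i _ j _ => ?_, y,
    hcl z y (fun p => hW.glue_mem (fun k => hxW _) _) hlim, fun r hr => ?_⟩
  · filter_upwards [glue_ae κ i, glue_ae κ j, h] with ω h1 h2 h3 hij
    rw [h1, h2]
    exact h3.1 hij
  -- The least threshold for the radius `r ω` is itself a conditional index.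
  · obtain ⟨m, hm⟩ := exists_index (μ := μ)
      (P := fun N ω => ∀ k ≥ N, eucDist (z k ω) (y ω) < (r ω : ℝ)) fun N => by
        have : {ω | ∀ k ≥ N, eucDist (z k ω) (y ω) < (r ω : ℝ)} =
            ⋂ k, ⋂ _ : k ≥ N, {ω | eucDist (z k ω) (y ω) < (r ω : ℝ)} := by ext; simp
        rw [this]
        exact .iInter fun k => .iInter fun _ => measurableSet_lt
          (measurable_eucDist (z k).measurable y.measurable)
          (Rat.continuous_coe_real.measurable.comp r.measurable)
    refine ⟨m, fun k hk => ?_⟩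
    filter_upwards [hm, hlim, hr, hk, hx.ae_eq (glue κ k), glue_ae κ k, hz]
      with ω h1 h2 h3 h4 h5 h6 h7
    have h8 : Tendsto (fun p => eucDist (z p ω) (y ω)) atTop (𝓝 0) := by
      have := (continuous_eucDist.tendsto (y ω, y ω)).comp (h2.prodMk_nhds tendsto_const_nhds)
      rwa [eucDist_self] at this
    have h9 := (h1 (eventually_atTop.1 (h8.eventually_lt_const (by exact_mod_cast h3)))).1 _ h4
    rw [h5, h6]
    simpa only [z, h7] using h9

end Compactness

/-! ### Selections of compact-valued maps -/

section Selections

variable {Ω : Type*} [MeasurableSpace Ω] {μ : Measure Ω}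

theorem exists_fiber_part (k : ℕ) : ∃ f : EucVec → EuclideanSpace ℝ (Fin k), Measurable f ∧
    ∀ v, f ⟨k, v⟩ = v := by
  refine ⟨fun v => if h : v.1 = k then h ▸ v.2 else 0, Continuous.measurable ?_, fun v => by simp⟩
  refine continuous_sigma fun l => ?_
  by_cases h : l = k
  · subst h; simpa using continuous_id'
  · simpa [h] using continuous_const

/-- Each `xₖ` must be a selection on all of `Ω`; `hne` provides its values off `A k`. -/
theorem mem_eucConcat_aeSelections_iff {A : ℕ → Set Ω} (hA : ∀ k, MeasurableSet (A k)) {d : ℕ → ℕ}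
    {X : ∀ k, Ω → Set (EuclideanSpace ℝ (Fin (d k)))}
    (hne : ∀ k, (aeSelections μ (X k)).Nonempty) {y : Ω →ₘ[μ] EucVec} :
    y ∈ eucConcat A d (fun k => aeSelections μ (X k)) ↔
      ∀ᵐ ω ∂μ, ∀ k, ω ∈ A k → y ω ∈ Sigma.mk (d k) '' X k ω := by
  constructor
  · rintro ⟨x, hx, hxy⟩
    filter_upwards [ae_all_iff.2 hx, ae_all_iff.2 hxy] with ω h1 h2 k hk
    exact ⟨_, h1 k, (h2 k hk).symm⟩
  · intro h
    choose w hw using hne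
    choose f hf hfk using fun k => exists_fiber_part (d k)
    have hm := fun k => ((hf k).comp y.measurable).stronglyMeasurable.aestronglyMeasurable (μ := μ)
    choose x _ hx1 hx2 using fun k => (isStable_univ (w k)).exists_ite
      (Set.mem_univ (AEEqFun.mk _ (hm k))) (Set.mem_univ (w k)) (hA k)
    refine ⟨x, fun k => ?_, fun k => ?_⟩
    · change ∀ᵐ ω ∂μ, x k ω ∈ X k ω
      filter_upwards [hx1 k, hx2 k, h, AEEqFun.coeFn_mk _ (hm k), hw k] with ω h1 h2 h3 h4 h5
      by_cases hω : ω ∈ A k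
      · obtain ⟨v, hv, hvy⟩ := h3 k hω
        rw [h1 hω, h4, Function.comp_apply, ← hvy, hfk]
        exact hv
      · rw [h2 hω]; exact h5
    · filter_upwards [hx1 k, h, AEEqFun.coeFn_mk _ (hm k)] with ω h1 h3 h4 hω
      obtain ⟨v, hv, hvy⟩ := h3 k hω
      rw [h1 hω, h4, Function.comp_apply, ← hvy, hfk]

theorem isCondCompact_eucConcat {A : ℕ → Set Ω} (hA : IsPartition μ A) {d : ℕ → ℕ}
    {X : ∀ k, Ω → Set (EuclideanSpace ℝ (Fin (d k)))} (hX : ∀ k ω, IsCompact (X k ω))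
    (hW : IsStable (eucConcat A d (fun k => aeSelections μ (X k)))) :
    IsCondCompact (eucConcat A d (fun k => aeSelections μ (X k))) := by
  have hne : ∀ k, (aeSelections μ (X k)).Nonempty := fun k => by
    obtain ⟨y, x, hx, -⟩ := hW.1
    exact ⟨x k, hx k⟩
  have hmem := fun y => mem_eucConcat_aeSelections_iff (y := y) hA.1 hne
  have hK : ∀ k ω, IsCompact (Sigma.mk (d k) '' X k ω : Set EucVec) := fun k ω =>
    (hX k ω).image continuous_sigmaMk
  refine isCondCompact_of_closed hW (fun x hx => ?_) fun x y hx hxy => (hmem y).2 ?_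
  · filter_upwards [hA.2.2, ae_all_iff.2 fun k => (hmem _).1 (hx k)] with ω h1 h2
    obtain ⟨k, hk⟩ := Set.mem_iUnion.1 h1
    exact ⟨_, hK k ω, fun l => h2 l k hk⟩
  · filter_upwards [hxy, ae_all_iff.2 fun k => (hmem _).1 (hx k)] with ω h1 h2 k hk
    exact (hK k ω).isClosed.mem_of_tendsto h1 (Eventually.of_forall fun l => h2 l k hk)

end Selections

/-! ### Pointwise dense sequences -/

section DenseSequence

variable {Ω : Type*} [MeasurableSpace Ω] {μ : Measure Ω} [SigmaFinite μ]
variable {E : Type*} [TopologicalSpace E] [PseudoMetrizableSpace E] [SecondCountableTopology E]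

/-- A stable set has a countable subset which is pointwise dense. -/
theorem IsStable.exists_dense_seq {W : Set (Ω →ₘ[μ] E)} (hW : IsStable W) :
    ∃ x : ℕ → (Ω →ₘ[μ] E), (∀ k, x k ∈ W) ∧
      ∀ y ∈ W, ∀ᵐ ω ∂μ, y ω ∈ closure (Set.range fun k => x k ω) := by
  borelize E
  have hb := isBasis_countableBasis E
  have : Countable (countableBasis E) := (countable_countableBasis E).to_subtype
  -- For each basic open set, an element of `W` lying in it as often as possible. `none` imposes
  -- nothing and keeps the index type nonempty.
  choose z hzW hz using fun b : Option (countableBasis E) => hW.exists_maximal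
    (P := fun _ v => ∀ s, b = some s → v ∈ s.1) fun x => by
      rcases b with _ | s
      · simp
      · have := x.measurable (isOpen_of_mem_countableBasis s.2).measurableSet
        have h : {ω | ∀ t, some s = some t → x ω ∈ t.1} = x ⁻¹' s.1 := by ext; simp
        rwa [h]
  obtain ⟨b, hbs⟩ := exists_surjective_nat (Option (countableBasis E))
  refine ⟨fun k => z (b k), fun k => hzW _, fun y hy => ?_⟩
  filter_upwards [ae_all_iff.2 fun s => hz s y hy] with ω h
  refine hb.mem_closure_iff.2 fun o ho hyo => ?_
  obtain ⟨k, hk⟩ := hbs (some ⟨o, ho⟩)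
  refine ⟨z (b k) ω, ?_, k, rfl⟩
  rw [hk]
  exact h (some ⟨o, ho⟩) (fun s hs => by cases hs; exact hyo) _ rfl

end DenseSequence

/-! ### Rational balls in all dimensions -/

section RationalBalls

theorem exists_eq_mk {u : EucVec} {k : ℕ} (h : u.1 = k) : ∃ v, u = ⟨k, v⟩ := by
  subst h
  exact ⟨u.2, rfl⟩

theorem exists_rational_balls : ∃ (c : ℕ → EucVec) (ρ : ℕ → ℚ), (∀ j, 0 < ρ j) ∧
    (∀ j m, ∃ a : ℚ, (c j).2 m = (a : ℝ)) ∧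
    ∀ u : EucVec, ∀ ε > 0, ∃ j, (c j).1 = u.1 ∧ eucDist u (c j) < ρ j ∧ (ρ j : ℝ) < ε := by
  have : Nonempty ((Σ k, Fin k → ℚ) × {ρ : ℚ // 0 < ρ}) := ⟨⟨0, 0⟩, 1, one_pos⟩
  obtain ⟨b, hb⟩ := exists_surjective_nat ((Σ k, Fin k → ℚ) × {ρ : ℚ // 0 < ρ})
  refine ⟨fun j => ⟨(b j).1.1, WithLp.toLp 2 fun m => ((b j).1.2 m : ℝ)⟩, fun j => (b j).2.1,
    fun j => (b j).2.2, fun j m => ⟨_, rfl⟩, fun u ε hε => ?_⟩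
  obtain ⟨ρ, hρ0, hρ⟩ := exists_rat_btwn hε
  have hρ0 : 0 < ρ := by exact_mod_cast hρ0
  obtain ⟨a, ha⟩ := exists_rat_eucDist_lt u (show (0 : ℝ) < ρ by exact_mod_cast hρ0)
  obtain ⟨j, hj⟩ := hb (⟨u.1, a⟩, ⟨ρ, hρ0⟩)
  refine ⟨j, ?_⟩
  dsimp only
  rw [hj]
  exact ⟨rfl, ha, hρ⟩

/-- Two distinct points exclude dimension `0`, so the space is unbounded. -/
theorem exists_lt_eucDist {u v : EucVec} (h : u.1 = v.1) (hne : u ≠ v) (R : ℝ) :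
    ∃ w : EucVec, w.1 = v.1 ∧ R < eucDist w v := by
  obtain ⟨k, u⟩ := u
  obtain ⟨l, v⟩ := v
  obtain rfl : k = l := h
  have : Nontrivial (EuclideanSpace ℝ (Fin k)) := ⟨u, v, fun h => hne (h ▸ rfl)⟩
  obtain ⟨w, hw⟩ := NormedSpace.exists_lt_norm ℝ (EuclideanSpace ℝ (Fin k)) R
  exact ⟨⟨k, v + w⟩, rfl, by simpa [eucDist_mk] using hw⟩

end RationalBalls

/-! ### From Heine–Borel to compact-valued maps -/

section HeineBorel

variable {Ω : Type*} [MeasurableSpace Ω] {μ : Measure Ω} {n : Ω →ₘ[μ] ℕ}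
  {W : Set (Ω →ₘ[μ] EucVec)}

/-- A set with the Heine–Borel property is bounded. -/
theorem HasCondHeineBorel.ae_exists_compact (hHB : HasCondHeineBorel n W) (hWn : W ⊆ condEuc n)
    {x : ℕ → (Ω →ₘ[μ] EucVec)} (hx : ∀ k, x k ∈ W) :
    ∀ᵐ ω ∂μ, ∃ K : Set EucVec, IsCompact K ∧ (∀ v ∈ K, v.1 = n ω) ∧ ∀ k, x k ω ∈ K := by
  let o : Ω →ₘ[μ] EucVec := glue (fun k => AEEqFun.const Ω ⟨k, 0⟩) n
  have ho : ∀ᵐ ω ∂μ, o ω = ⟨n ω, 0⟩ := by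
    filter_upwards [glue_ae (fun k => AEEqFun.const Ω (⟨k, 0⟩ : EucVec)) n,
      ae_all_iff.2 fun k => const_ae (Ω := Ω) (μ := μ) (⟨k, 0⟩ : EucVec)] with ω h1 h2
    rw [h1, h2]
  have hc : ∀ᵐ ω ∂μ, ∀ i : ℕ, (AEEqFun.const Ω ((i : ℚ) + 1) : Ω →ₘ[μ] ℚ) ω = (i : ℚ) + 1 :=
    ae_all_iff.2 fun i => const_ae _
  have horat : o ∈ condRatEuc n := by
    constructor <;> filter_upwards [ho] with ω h
    · rw [h]
    · have : ∀ u : EucVec, u = ⟨n ω, 0⟩ → ∀ m, ∃ a : ℚ, u.2 m = (a : ℝ) := by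
        rintro _ rfl m
        exact ⟨0, by simp⟩
      exact this _ h
  -- The cover consists of balls about the origin; the radius `i + 1` is positive at `i = 0` too.
  obtain ⟨M, hM⟩ := hHB.exists_bound hWn (q := fun _ _ => o)
    (r := fun i _ => AEEqFun.const Ω ((i : ℚ) + 1)) (fun _ _ => horat)
    (fun i _ => by
      filter_upwards [hc] with ω h
      rw [h]
      positivity)
    (fun y _ => by
      filter_upwards [ho, hc] with ω h h'
      obtain ⟨i, hi⟩ := exists_nat_gt (eucDist (y ω) ⟨n ω, 0⟩)
      refine ⟨i, 0, ?_⟩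
      rw [h, h']
      push_cast
      linarith)
  filter_upwards [ae_all_iff.2 fun k => hM _ (hx k), ho, hc, ae_all_iff.2 fun k => hWn (hx k)]
    with ω h1 h2 h3 h4
  refine ⟨Sigma.mk (n ω) '' Metric.closedBall 0 (M ω + 1),
    (isCompact_closedBall _ _).image continuous_sigmaMk, ?_, fun k => ?_⟩
  · rintro _ ⟨v, -, rfl⟩
    rfl
  · obtain ⟨v, hv⟩ := exists_eq_mk (h4 k)
    obtain ⟨i, hi, _, hlt⟩ := h1 k
    rw [hv, h2, h3, eucDist_mk, sub_zero] at hlt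
    rw [hv]
    refine ⟨v, ?_, rfl⟩
    rw [mem_closedBall_zero_iff]
    have : (i : ℝ) ≤ M ω := by exact_mod_cast hi
    push_cast at hlt
    linarith

/-- A set with the Heine–Borel property is closed. -/
theorem HasCondHeineBorel.mem_of_ae_mem_closure [SigmaFinite μ] (hHB : HasCondHeineBorel n W)
    (hWn : W ⊆ condEuc n) (hW : IsStable W) {x : ℕ → (Ω →ₘ[μ] EucVec)} (hx : ∀ k, x k ∈ W)
    {y : Ω →ₘ[μ] EucVec} (hyn : y ∈ condEuc n)
    (hy : ∀ᵐ ω ∂μ, y ω ∈ closure (Set.range fun k => x k ω)) : y ∈ W := by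
  obtain ⟨z, hzW, hz⟩ := hW.exists_maximal (P := fun ω v => v = y ω)
    fun x => measurableSet_eq_fun x.measurable y.measurable
  obtain ⟨c, ρ, hρ, hcrat, hball⟩ := exists_rational_balls
  -- Where `z ≠ y`, admissible balls stay more than `1 / (i + 1)` away from `y`. Where `z = y`
  -- nothing needs proof, and all balls of the right dimension are allowed so that `W` is still
  -- covered.
  let P : ℕ → ℕ → Ω → Prop := fun i j ω => (c j).1 = n ω ∧
    (z ω = y ω ∨ ρ j + 1 / ((i : ℝ) + 1) < eucDist (c j) (y ω))
  have hPm : ∀ i j, MeasurableSet {ω | P i j ω} := fun i j =>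
    (measurableSet_eq_fun measurable_const n.measurable).inter
      ((measurableSet_eq_fun z.measurable y.measurable).union
        (measurableSet_lt measurable_const (measurable_eucDist measurable_const y.measurable)))
  have hfar : ∀ᵐ ω ∂μ, ∀ (w : EucVec) (i : ℕ), w.1 = n ω →
      1 / ((i : ℝ) + 1) < eucDist w (y ω) → ∃ j, P i j ω ∧ eucDist w (c j) < ρ j := by
    filter_upwards [hyn] with ω h1 w i hw hlt
    -- The radius is below half the slack: it is subtracted once for `w` and once for the ball
    -- itself.
    obtain ⟨j, hj1, hj2, hj3⟩ := hball w _ (half_pos (sub_pos.2 hlt))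
    refine ⟨j, ⟨hj1.trans hw, Or.inr ?_⟩, hj2⟩
    have := eucDist_triangle hj1.symm ((hj1.trans hw).trans h1.symm)
    linarith
  have hnear : ∀ᵐ ω ∂μ, ∀ (w : EucVec) (i : ℕ), w.1 = n ω → z ω = y ω →
      ∃ j, P i j ω ∧ eucDist w (c j) < ρ j := by
    refine Eventually.of_forall fun ω w i hw hzy => ?_
    obtain ⟨j, hj1, hj2, -⟩ := hball w 1 one_pos
    exact ⟨j, ⟨hj1.trans hw, Or.inl hzy⟩, hj2⟩
  have hex : ∀ᵐ ω ∂μ, ∀ i, ∃ j, P i j ω := by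
    filter_upwards [hfar, hnear, hyn, hWn hzW] with ω h1 h2 h3 h4 i
    by_cases hzy : z ω = y ω
    · exact (h2 _ i h4 hzy).imp fun j hj => hj.1
    · obtain ⟨w, hw, hlt⟩ := exists_lt_eucDist (h4.trans h3.symm) hzy (1 / ((i : ℝ) + 1))
      exact (h1 w i (hw.trans h3) hlt).imp fun j hj => hj.1
  -- Every member of the cover must be a ball of dimension `n ω`, so an inadmissible `j` is replaced
  -- by an admissible index.
  choose J hJ using fun i j => exists_index (μ := μ)
    (P := fun k ω => P i k ω ∧ (¬ P i j ω ∨ k = j)) fun k =>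
      (hPm i k).inter ((hPm i j).compl.union (MeasurableSet.const _))
  have hJP : ∀ᵐ ω ∂μ, ∀ i j, P i (J i j ω) ω ∧ (P i j ω → J i j ω = j) := by
    filter_upwards [hex, ae_all_iff.2 fun i => ae_all_iff.2 (hJ i)] with ω h1 h2 i j
    have h3 : ∃ k, P i k ω ∧ (¬ P i j ω ∨ k = j) := by
      by_cases h : P i j ω
      · exact ⟨j, h, Or.inr rfl⟩
      · obtain ⟨k, hk⟩ := h1 i
        exact ⟨k, hk, Or.inl h⟩
    obtain ⟨h4, h5⟩ := (h2 i j h3).1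
    exact ⟨h4, fun h => h5.resolve_left (not_not.2 h)⟩
  let q : ℕ → ℕ → (Ω →ₘ[μ] EucVec) := fun i j => glue (fun k => AEEqFun.const Ω (c k)) (J i j)
  let r : ℕ → ℕ → (Ω →ₘ[μ] ℚ) := fun i j => glue (fun k => AEEqFun.const Ω (ρ k)) (J i j)
  have hq : ∀ᵐ ω ∂μ, ∀ i j, q i j ω = c (J i j ω) := by
    filter_upwards [ae_all_iff.2 fun i => ae_all_iff.2 fun j =>
      glue_ae (fun k => AEEqFun.const Ω (c k)) (J i j),
      ae_all_iff.2 fun k => const_ae (Ω := Ω) (μ := μ) (c k)] with ω h1 h2 i j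
    rw [h1, h2]
  have hr : ∀ᵐ ω ∂μ, ∀ i j, r i j ω = ρ (J i j ω) := by
    filter_upwards [ae_all_iff.2 fun i => ae_all_iff.2 fun j =>
      glue_ae (fun k => AEEqFun.const Ω (ρ k)) (J i j),
      ae_all_iff.2 fun k => const_ae (Ω := Ω) (μ := μ) (ρ k)] with ω h1 h2 i j
    rw [h1, h2]
  have hqn : ∀ i j, q i j ∈ condRatEuc n := by
    intro i j
    constructor <;> filter_upwards [hq, hJP] with ω h1 h2 <;> rw [h1]
    exacts [(h2 i j).1.1, hcrat _]
  have hrp : ∀ i j, r i j ∈ posRat μ := by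
    intro i j
    filter_upwards [hr] with ω h1
    rw [h1]
    exact hρ _
  have hcov : ∀ w ∈ W, ∀ᵐ ω ∂μ, ∃ i, Covered (q i) (r i) ω (w ω) := by
    intro w hw
    filter_upwards [hfar, hnear, hq, hr, hJP, hWn hw, hyn, hz w hw] with ω h1 h2 h3 h4 h5 h6 h7 h8
    obtain ⟨i, j, hP, hlt⟩ : ∃ i j, P i j ω ∧ eucDist (w ω) (c j) < ρ j := by
      by_cases hzy : z ω = y ω
      · exact ⟨0, h2 _ 0 h6 hzy⟩
      -- By maximality of `z`, no element of `W` meets `y` where `z` does not.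
      · have hpos : 0 < eucDist (w ω) (y ω) := by
          by_contra! hle
          exact hzy (h8 (eq_of_eucDist_le_zero (h6.trans h7.symm) hle))
        obtain ⟨i, hi⟩ := exists_nat_one_div_lt hpos
        exact ⟨i, h1 _ i h6 hi⟩
    refine ⟨i, j, ?_⟩
    rw [h3, h4, (h5 i j).2 hP]
    exact hlt
  obtain ⟨M, hM⟩ := hHB.exists_bound hWn hqn hrp hcov
  refine (AEEqFun.ext ?_ : z = y) ▸ hzW
  filter_upwards [ae_all_iff.2 fun k => hM _ (hx k), hq, hr, hJP, hy, hyn,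
    ae_all_iff.2 fun k => hWn (hx k)] with ω h1 h2 h3 h4 h5 h6 h7
  by_contra hzy
  -- Where `z ≠ y`, the bound `M` keeps every `x k ω` at distance at least `1 / (M ω + 1)` from `y
  -- ω`, against density.
  have hopen : IsOpen {v | eucDist v (y ω) < 1 / ((M ω : ℝ) + 1)} :=
    isOpen_lt (continuous_eucDist.comp (continuous_id.prodMk continuous_const)) continuous_const
  obtain ⟨_, hlt, k, rfl⟩ := mem_closure_iff.1 h5 _ hopen (by
    change eucDist _ _ < _
    rw [eucDist_self]
    positivity)
  have hlt : eucDist (x k ω) (y ω) < 1 / ((M ω : ℝ) + 1) := hlt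
  obtain ⟨i, hi, j, hij⟩ := h1 k
  rw [h2, h3] at hij
  obtain ⟨hdim, hor⟩ := (h4 i j).1
  have h8 := hor.resolve_left hzy
  have h9 := eucDist_triangle (hdim.trans (h7 k).symm) ((h7 k).trans h6.symm)
  rw [eucDist_comm (hdim.trans (h7 k).symm)] at h9
  have h10 : 1 / ((M ω : ℝ) + 1) ≤ 1 / ((i : ℝ) + 1) := by gcongr
  linarith

/-- A stable set with the Heine–Borel property consists of the selections of a compact-valued
map. -/
theorem HasCondHeineBorel.exists_selections [SigmaFinite μ] {A : ℕ → Set Ω} {d : ℕ → ℕ}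
    (hA : IsPartition μ A) (hn : IsConcat A (fun k => AEEqFun.const Ω (d k)) n)
    (hHB : HasCondHeineBorel n W) (hWn : W ⊆ condEuc n) (hW : IsStable W) :
    ∃ X : ∀ k, Ω → Set (EuclideanSpace ℝ (Fin (d k))),
      (∀ k, IsEffrosMeasurable (X k)) ∧ (∀ k ω, IsCompact (X k ω)) ∧
        W = eucConcat A d (fun k => aeSelections μ (X k)) := by
  classical
  obtain ⟨x, hxW, hx⟩ := hW.exists_dense_seq
  have hgood : ∀ᵐ ω ∂μ, (∃ K : Set EucVec, IsCompact K ∧ (∀ v ∈ K, v.1 = n ω) ∧ ∀ k, x k ω ∈ K) ∧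
      ∀ k, ω ∈ A k → n ω = d k := by
    filter_upwards [hHB.ae_exists_compact hWn hxW, ae_all_iff.2 hn,
      ae_all_iff.2 fun k => const_ae (Ω := Ω) (μ := μ) (d k)] with ω h1 h2 h3
    exact ⟨h1, fun k hk => (h2 k hk).trans (h3 k)⟩
  -- Compactness is required at every `ω`, so a measurable null set is removed, and `X k` is set to
  -- `{0}` on it and off `A k`.
  obtain ⟨N, hN, hNm, hN0⟩ := exists_measurable_superset_of_null (ae_iff.1 hgood)
  have hNae : ∀ᵐ ω ∂μ, ω ∉ N := measure_eq_zero_iff_ae_notMem.1 hN0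
  have hgood : ∀ ω ∉ N, (∃ K : Set EucVec, IsCompact K ∧ (∀ v ∈ K, v.1 = n ω) ∧
      ∀ k, x k ω ∈ K) ∧ ∀ k, ω ∈ A k → n ω = d k := fun ω hω => by
    by_contra h
    exact hω (hN h)
  let Y : Ω → Set EucVec := fun ω => closure (Set.range fun k => x k ω)
  have hY : ∀ ω ∉ N, IsCompact (Y ω) ∧ ∀ v ∈ Y ω, v.1 = n ω := fun ω hω => by
    obtain ⟨K, hK, hKn, hxK⟩ := (hgood ω hω).1
    have hYK : Y ω ⊆ K := closure_minimal (Set.range_subset_iff.2 hxK) hK.isClosed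
    exact ⟨hK.of_isClosed_subset isClosed_closure hYK, fun v hv => hKn v (hYK hv)⟩
  let X : ∀ k, Ω → Set (EuclideanSpace ℝ (Fin (d k))) := fun k ω =>
    if ω ∈ A k \ N then (fun v => (⟨d k, v⟩ : EucVec)) ⁻¹' Y ω else {0}
  have hB : ∀ k, MeasurableSet (A k \ N) := fun k => (hA.1 k).diff hNm
  have hXY : ∀ k, ∀ ω ∈ A k \ N, ∀ u ∈ Y ω, u ∈ Sigma.mk (d k) '' X k ω := by
    intro k ω hω u hu
    obtain ⟨v, rfl⟩ := exists_eq_mk (((hY ω hω.2).2 u hu).trans ((hgood ω hω.2).2 k hω.1))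
    refine ⟨v, ?_, rfl⟩
    simp only [X, if_pos hω]
    exact hu
  have hne : ∀ k, (aeSelections μ (X k)).Nonempty := by
    intro k
    obtain ⟨f, hf, hfk⟩ := exists_fiber_part (d k)
    have hm := (hf.comp (x 0).measurable).stronglyMeasurable.aestronglyMeasurable (μ := μ)
    obtain ⟨w, -, hw1, hw2⟩ := (isStable_univ (AEEqFun.mk _ hm)).exists_ite (Set.mem_univ
      (AEEqFun.mk _ hm)) (Set.mem_univ (AEEqFun.const Ω 0)) (hB k)
    refine ⟨w, ?_⟩
    change ∀ᵐ ω ∂μ, w ω ∈ X k ω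
    filter_upwards [hw1, hw2, AEEqFun.coeFn_mk _ hm,
      const_ae (Ω := Ω) (μ := μ) (0 : EuclideanSpace ℝ (Fin (d k)))] with ω h1 h2 h3 h4
    by_cases hω : ω ∈ A k \ N
    · obtain ⟨v, hv, hvx⟩ := hXY k ω hω (x 0 ω) (subset_closure ⟨0, rfl⟩)
      rw [h1 hω, h3, Function.comp_apply, ← hvx, hfk]
      exact hv
    · rw [h2 hω, h4]
      simp only [X, if_neg hω, Set.mem_singleton_iff]
  refine ⟨X, fun k U hU => ?_, fun k ω => ?_, ?_⟩
  · have hUo : IsOpen ((fun v => (⟨d k, v⟩ : EucVec)) '' U) :=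
      isOpenMap_sigmaMk (σ := fun l => EuclideanSpace ℝ (Fin l)) U hU
    -- An open set meets the closure exactly when it contains some `x j ω`; this leaves a countable
    -- union.
    have hset : {ω | (X k ω ∩ U).Nonempty} =
        ((A k \ N) ∩ ⋃ j, {ω | x j ω ∈ (fun v => (⟨d k, v⟩ : EucVec)) '' U}) ∪
          ((A k \ N)ᶜ ∩ {_ω | (0 : EuclideanSpace ℝ (Fin (d k))) ∈ U}) := by
      ext ω
      by_cases hω : ω ∈ A k \ N
      · have : (X k ω ∩ U).Nonempty ↔ ∃ j, x j ω ∈ (fun v => (⟨d k, v⟩ : EucVec)) '' U := by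
          simp only [X, if_pos hω]
          constructor
          · rintro ⟨v, hv, hvU⟩
            obtain ⟨_, h, j, rfl⟩ := mem_closure_iff.1 hv _ hUo ⟨v, hvU, rfl⟩
            exact ⟨j, h⟩
          · rintro ⟨j, v, hv, hvx⟩
            exact ⟨v, subset_closure ⟨j, hvx.symm⟩, hv⟩
        simpa [hω] using this
      · have : (X k ω ∩ U).Nonempty ↔ (0 : EuclideanSpace ℝ (Fin (d k))) ∈ U := by
          rw [show X k ω = {0} from if_neg hω, Set.singleton_inter_nonempty]
        simp only [Set.mem_union, Set.mem_inter_iff, Set.mem_compl_iff, hω, false_and, false_or,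
          not_false_iff, true_and]
        exact this
    rw [hset]
    exact ((hB k).inter (.iUnion fun j => (x j).measurable hUo.measurableSet)).union
      ((hB k).compl.inter (MeasurableSet.const _))
  · by_cases hω : ω ∈ A k \ N
    · simp only [X, if_pos hω]
      exact IsClosedEmbedding.sigmaMk.isCompact_preimage (hY ω hω.2).1
    · simp only [X, if_neg hω]
      exact isCompact_singleton
  · ext y
    rw [mem_eucConcat_aeSelections_iff hA.1 hne]
    constructor
    · intro hy
      filter_upwards [hNae, hx y hy] with ω h1 h2 k hk
      exact hXY k ω ⟨hk, h1⟩ _ h2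
    · intro hy
      have hyY : ∀ᵐ ω ∂μ, ω ∉ N ∧ y ω ∈ Y ω := by
        filter_upwards [hNae, hA.2.2, hy] with ω h1 h2 h3
        obtain ⟨k, hk⟩ := Set.mem_iUnion.1 h2
        obtain ⟨v, hv, hvy⟩ := h3 k hk
        simp only [X, if_pos (show ω ∈ A k \ N from ⟨hk, h1⟩)] at hv
        exact ⟨h1, hvy ▸ hv⟩
      exact hHB.mem_of_ae_mem_closure hWn hW hxW
        (hyY.mono fun ω h => (hY ω h.1).2 _ h.2) (hyY.mono fun ω h => h.2)

end HeineBorel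

end CondAnalysis

theorem mainTheorem8 {Ω : Type*} [MeasurableSpace Ω] (μ : Measure Ω) [SigmaFinite μ]
    (n : Ω →ₘ[μ] ℕ) (A : ℕ → Set Ω) (d : ℕ → ℕ)
    (hA : CondAnalysis.IsPartition μ A)
    (hn : CondAnalysis.IsConcat A (fun k => AEEqFun.const Ω (d k)) n)
    (W : Set (Ω →ₘ[μ] CondAnalysis.EucVec))
    (hWn : W ⊆ CondAnalysis.condEuc n) (hW : CondAnalysis.IsStable W) :
    List.TFAE
      [CondAnalysis.IsCondCompact W,
       CondAnalysis.HasCondHeineBorel n W,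
       ∃ X : ∀ k, Ω → Set (EuclideanSpace ℝ (Fin (d k))),
         (∀ k, CondAnalysis.IsEffrosMeasurable (X k)) ∧ (∀ k ω, IsCompact (X k ω)) ∧
           W = CondAnalysis.eucConcat A d (fun k => CondAnalysis.aeSelections μ (X k))] := by
  tfae_have 1 → 2 := fun h => h.hasCondHeineBorel hWn hW
  tfae_have 2 → 3 := fun h => h.exists_selections hA hn hWn hW
  tfae_have 3 → 1 := by
    rintro ⟨X, -, hX, rfl⟩
    exact CondAnalysis.isCondCompact_eucConcat hA hX hW
  tfae_finish
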